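/- Let $k$ be an algebraically closed field of characteristic zero, let $G$ be a finite group with a $\mathbb Z/2$-grading, i.e. a homomorphism $G\to\mathbb Z/2$, $g\mapsto\bar g$, and let $c:G\times G\to k^*$ be a 2-cocycle, i.e. $c(g,h)\,c(gh,j)=c(h,j)\,c(g,hj)$ for all $g,h,j\in G$. Let $k[G]^c$ be the twisted group superalgebra: the associative $k$-algebra with basis $\{e_g\mid g\in G\}$, multiplication $e_g\cdot e_h=c(g,h)\,e_{gh}$, and $\mathbb Z/2$-grading $\deg(e_g)=\bar g$. Consider the category of right $k[G]^c$-supermodules $M=M_{\bar 0}\oplus M_{\bar 1}$ and even (grading preserving) morphisms, with parity shift $(\Pi M)_{\bar 0}=M_{\bar 1}$, $(\Pi M)_{\bar 1}=M_{\bar 0}$. An irreducible supermodule $M$ (nonzero, with no graded submodules except $0$ and $M$) is called self-associate if $M\cong\Pi M$. A conjugacy class $[g]\subset G$ is called $c$-regular if $c(g,h)=c(h,g)$ for all $h$ in the centralizer of $g$, and it is called even or odd according to $\bar g$. Then the number of isomorphism classes of irreducible right $k[G]^c$-supermodules, up to parity shift, is finite and equals the number of even $c$-regular conjugacy classes in $G$.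 Among these isomorphism classes, the number of self-associate ones equals the number of odd $c$-regular conjugacy classes in $G$. -/

import Mathlib

open scoped DirectSum

universe u v w x

noncomputable section

/-- A 2-cocycle of the group `G` with values in `kˣ` (trivial action). -/
structure TwoCocycle (G : Type v) [Group G] (k : Type u) [Field k] where
  toFun : G → G → kˣ
  cocycle : ∀ g h j : G, toFun g h * toFun (g * h) j = toFun h j * toFun g (h * j)

instance {G : Type v} [Group G] {k : Type u} [Field k] :
    CoeFun (TwoCocycle G k) (fun _ => G → G → kˣ) := ⟨TwoCocycle.toFun⟩

namespace TwoCocycle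

variable {G : Type v} [Group G] {k : Type u} [Field k] (c : TwoCocycle G k)

theorem one_left (j : G) : c 1 j = c 1 1 := by
  have h := c.cocycle 1 1 j
  simp only [one_mul] at h
  exact (mul_right_cancel h).symm

theorem one_right (g : G) : c g 1 = c 1 1 := by
  have h := c.cocycle g 1 1
  simp only [mul_one] at h
  exact mul_right_cancel h

/-- The conjugacy class `C` is `c`-regular: `c(g,h) = c(h,g)` for `g ∈ C` and all `h` in the
centralizer of `g`. -/
def IsRegular (C : ConjClasses G) : Prop :=
  ∀ g ∈ C.carrier, ∀ h ∈ Subgroup.centralizer ({g} : Set G), c g h = c h g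

end TwoCocycle

/-- Let `deg` be a `ℤ/2`-grading of the group `G`. The conjugacy class `C` has degree `i`. -/
def ConjClassHasDegree {G : Type v} [Group G] (deg : G →* Multiplicative (ZMod 2))
    (C : ConjClasses G) (i : ZMod 2) : Prop :=
  ∀ g ∈ C.carrier, (deg g).toAdd = i

/-- The twisted group algebra `k[G]^c`: the vector space with basis `e_g`, `g ∈ G`. -/
def TwistedGroupAlgebra {G : Type v} [Group G] {k : Type u} [Field k] (_c : TwoCocycle G k) :
    Type (max u v) := G →₀ k

namespace TwistedGroupAlgebra

variable {G : Type v} [Group G] {k : Type u} [Field k] (c : TwoCocycle G k)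

instance : AddCommGroup (TwistedGroupAlgebra c) := inferInstanceAs (AddCommGroup (G →₀ k))

instance : Module k (TwistedGroupAlgebra c) := inferInstanceAs (Module k (G →₀ k))

/-- The basis `e_g`, `g ∈ G`. -/
def basis : Module.Basis G k (TwistedGroupAlgebra c) := ⟨LinearEquiv.refl k (G →₀ k)⟩

/-- The multiplication, i.e. the bilinear map with `e_g e_h = c(g,h) e_{gh}`. -/
def mulLin : TwistedGroupAlgebra c →ₗ[k] TwistedGroupAlgebra c →ₗ[k] TwistedGroupAlgebra c :=
  (basis c).constr k fun g => (basis c).constr k fun h => (c g h : k) • basis c (g * h)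

@[simp] theorem mulLin_basis (g h : G) :
    mulLin c (basis c g) (basis c h) = (c g h : k) • basis c (g * h) := by
  simp [mulLin]

instance : Mul (TwistedGroupAlgebra c) := ⟨fun a b => mulLin c a b⟩

/-- The unit `c(1,1)⁻¹ e_1`; it is `e_1` when `c` is normalized. -/
instance : One (TwistedGroupAlgebra c) := ⟨(((c 1 1)⁻¹ : kˣ) : k) • basis c 1⟩

theorem mul_def (a b : TwistedGroupAlgebra c) : a * b = mulLin c a b := rfl

theorem one_def : (1 : TwistedGroupAlgebra c) = (((c 1 1)⁻¹ : kˣ) : k) • basis c 1 := rfl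

protected theorem induction {p : TwistedGroupAlgebra c → Prop} (a : TwistedGroupAlgebra c)
    (h0 : p 0) (hadd : ∀ a b, p a → p b → p (a + b)) (hs : ∀ (r : k) g, p (r • basis c g)) :
    p a := by
  rw [← (basis c).linearCombination_repr a]
  generalize (basis c).repr a = f
  induction f using Finsupp.induction_linear with
  | zero => simpa using h0
  | add f g hf hg => simpa using hadd _ _ hf hg
  | single g r => simpa using hs r g

protected theorem mul_assoc' (a b d : TwistedGroupAlgebra c) :
    mulLin c (mulLin c a b) d = mulLin c a (mulLin c b d) := by
  induction a using TwistedGroupAlgebra.induction with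
  | h0 => simp
  | hadd a a' h h' => simp [h, h']
  | hs r g =>
  induction b using TwistedGroupAlgebra.induction with
  | h0 => simp
  | hadd a a' h h' => simp_all
  | hs s h =>
  induction d using TwistedGroupAlgebra.induction with
  | h0 => simp
  | hadd a a' h h' => rw [map_add, h, h', map_add, map_add]
  | hs t j =>
  have hc := congrArg (fun z : kˣ => (z : k)) (c.cocycle g h j)
  simp only [Units.val_mul] at hc
  simp only [map_smul, LinearMap.smul_apply, mulLin_basis, smul_smul, mul_assoc g h j]
  congr 1
  linear_combination (r * s * t) * hc

protected theorem one_mul' (a : TwistedGroupAlgebra c) : mulLin c 1 a = a := by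
  induction a using TwistedGroupAlgebra.induction with
  | h0 => simp
  | hadd a a' h h' => simp [h, h']
  | hs r g => simp [one_def, smul_smul, c.one_left g]

protected theorem mul_one' (a : TwistedGroupAlgebra c) : mulLin c a 1 = a := by
  induction a using TwistedGroupAlgebra.induction with
  | h0 => simp
  | hadd a a' h h' => simp [h, h']
  | hs r g => simp [one_def, smul_smul, c.one_right g, mul_left_comm _ r]

instance : Ring (TwistedGroupAlgebra c) where
  __ := (inferInstance : AddCommGroup (TwistedGroupAlgebra c))
  left_distrib a b d := by simp only [mul_def, map_add]
  right_distrib a b d := by simp only [mul_def, map_add, LinearMap.add_apply]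
  zero_mul a := by simp only [mul_def, map_zero, LinearMap.zero_apply]
  mul_zero a := by simp only [mul_def, map_zero]
  mul_assoc a b d := TwistedGroupAlgebra.mul_assoc' c a b d
  one_mul a := TwistedGroupAlgebra.one_mul' c a
  mul_one a := TwistedGroupAlgebra.mul_one' c a

instance : Algebra k (TwistedGroupAlgebra c) :=
  Algebra.ofModule (fun r a b => by simp only [mul_def, map_smul, LinearMap.smul_apply])
    (fun r a b => by simp only [mul_def, map_smul])

theorem basis_mul_basis (g h : G) :
    basis c g * basis c h = (c g h : k) • basis c (g * h) := mulLin_basis c g h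

variable (deg : G →* Multiplicative (ZMod 2))

/-- The `ℤ/2`-grading of `k[G]^c` for which `e_g` has the degree of `g`. -/
def grading (i : ZMod 2) : Submodule k (TwistedGroupAlgebra c) :=
  Submodule.span k (basis c '' {g | (deg g).toAdd = i})

theorem basis_mem_grading (g : G) : basis c g ∈ grading c deg (deg g).toAdd :=
  Submodule.subset_span ⟨g, rfl, rfl⟩

instance : SetLike.GradedMonoid (grading c deg) where
  one_mem := by
    have h := basis_mem_grading c deg 1
    rw [map_one, toAdd_one] at h
    exact Submodule.smul_mem _ _ h
  mul_mem i j a b ha hb := by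
    induction ha using Submodule.span_induction with
    | zero => simp
    | add x y _ _ hx hy => rw [add_mul]; exact add_mem hx hy
    | smul r x _ hx => rw [smul_mul_assoc]; exact Submodule.smul_mem _ _ hx
    | mem x hx =>
    obtain ⟨g, rfl, rfl⟩ := hx
    induction hb using Submodule.span_induction with
    | zero => simp
    | add x y _ _ hx hy => rw [mul_add]; exact add_mem hx hy
    | smul r x _ hx => rw [mul_smul_comm]; exact Submodule.smul_mem _ _ hx
    | mem x hx =>
    obtain ⟨h, rfl, rfl⟩ := hx
    rw [basis_mul_basis, ← toAdd_mul, ← map_mul]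
    exact Submodule.smul_mem _ _ (basis_mem_grading c deg (g * h))

/-- The projections to the homogeneous components. -/
def decomposeLin : TwistedGroupAlgebra c →ₗ[k] ⨁ i, grading c deg i :=
  (basis c).constr k fun g =>
    DirectSum.lof k (ZMod 2) (fun i => grading c deg i) (deg g).toAdd
      ⟨basis c g, basis_mem_grading c deg g⟩

instance : GradedAlgebra (grading c deg) where
  toDecomposition := DirectSum.Decomposition.ofLinearMap (grading c deg) (decomposeLin c deg)
    (by
      refine (basis c).ext fun g => ?_
      simp [decomposeLin])
    (by
      ext i ⟨x, hx⟩ : 2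
      simp only [LinearMap.comp_apply, DirectSum.coeLinearMap_lof, LinearMap.id_apply]
      induction hx using Submodule.span_induction with
      | zero => rw [map_zero]; exact (map_zero _).symm
      | add x y hx' hy' hx hy =>
        rw [map_add, hx, hy, ← map_add]; rfl
      | smul r x _ hx => rw [map_smul, hx, ← map_smul]; rfl
      | mem x hx =>
      obtain ⟨g, rfl, rfl⟩ := hx
      simp [decomposeLin])

end TwistedGroupAlgebra

section Supermodules

variable {k : Type u} [Field k] {A : Type v} [Ring A] [Algebra k A]

/-- A right supermodule over the superalgebra `A = A_0 ⊕ A_1` over `k`: a right `A`-module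
with a decomposition `M = M_0 ⊕ M_1` such that `M_i A_j ⊆ M_{i+j}`. -/
structure Supermodule (𝒜 : ZMod 2 → Submodule k A) [GradedAlgebra 𝒜] where
  carrier : Type x
  [addCommGroup : AddCommGroup carrier]
  [module : Module k carrier]
  [rightModule : Module Aᵐᵒᵖ carrier]
  [isScalarTower : IsScalarTower k Aᵐᵒᵖ carrier]
  /-- The homogeneous component of degree `i`. -/
  part : ZMod 2 → Submodule k carrier
  isInternal : DirectSum.IsInternal part
  smul_mem : ∀ (i j : ZMod 2) (m : carrier) (a : A), m ∈ part i → a ∈ 𝒜 j →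
    MulOpposite.op a • m ∈ part (i + j)

namespace Supermodule

variable {𝒜 : ZMod 2 → Submodule k A} [GradedAlgebra 𝒜]

attribute [instance] addCommGroup module rightModule isScalarTower

instance : CoeSort (Supermodule.{u, v, x} 𝒜) (Type x) := ⟨carrier⟩

/-- An isomorphism in the category of supermodules and even morphisms. -/
structure EvenIso (M N : Supermodule.{u, v, x} 𝒜) where
  toEquiv : M ≃ₗ[Aᵐᵒᵖ] N
  map_part : ∀ (i : ZMod 2) (m : M), toEquiv m ∈ N.part i ↔ m ∈ M.part i

/-- The parity shift: `(Π M)_i = M_{i+1}`, with the same right action. -/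
def shift (M : Supermodule.{u, v, x} 𝒜) : Supermodule.{u, v, x} 𝒜 where
  carrier := M
  part i := M.part (i + 1)
  isInternal := by
    have h := M.isInternal
    rw [DirectSum.isInternal_submodule_iff_iSupIndep_and_iSup_eq_top] at h ⊢
    exact ⟨h.1.comp (add_left_injective 1), ((Equiv.addRight (1 : ZMod 2)).iSup_comp).trans h.2⟩
  smul_mem i j m a hm ha := by
    have h := M.smul_mem (i + 1) j m a hm ha
    rwa [add_right_comm] at h

/-- `M` is irreducible: it is nonzero, and its only graded submodules are `0` and `M`. -/
def IsIrreducible (M : Supermodule.{u, v, x} 𝒜) : Prop :=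
  Nontrivial M ∧ ∀ N : Submodule Aᵐᵒᵖ M,
    (∀ n ∈ N, ∃ n₀ ∈ N, ∃ n₁ ∈ N, n₀ ∈ M.part 0 ∧ n₁ ∈ M.part 1 ∧ n = n₀ + n₁) →
      N = ⊥ ∨ N = ⊤

/-- `M ≅ Π M`. -/
def IsSelfAssociate (M : Supermodule.{u, v, x} 𝒜) : Prop := Nonempty (EvenIso M M.shift)

/-- `M` and `N` are isomorphic up to parity shift: `M ≅ N` or `M ≅ Π N`. -/
def IsoUpToShift (M N : Supermodule.{u, v, x} 𝒜) : Prop :=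
  Nonempty (EvenIso M N) ∨ Nonempty (EvenIso M N.shift)

def EvenIso.refl (M : Supermodule.{u, v, x} 𝒜) : EvenIso M M :=
  ⟨LinearEquiv.refl _ _, fun _ _ => Iff.rfl⟩

def EvenIso.symm {M N : Supermodule.{u, v, x} 𝒜} (e : EvenIso M N) : EvenIso N M :=
  ⟨e.toEquiv.symm, fun i m => by simpa using (e.map_part i (e.toEquiv.symm m)).symm⟩

def EvenIso.trans {M N P : Supermodule.{u, v, x} 𝒜} (e : EvenIso M N) (f : EvenIso N P) :
    EvenIso M P :=
  ⟨e.toEquiv.trans f.toEquiv, fun i m => (f.map_part i _).trans (e.map_part i m)⟩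

def EvenIso.shift {M N : Supermodule.{u, v, x} 𝒜} (e : EvenIso M N) : EvenIso M.shift N.shift :=
  ⟨e.toEquiv, fun i m => e.map_part (i + 1) m⟩

def shiftShift (M : Supermodule.{u, v, x} 𝒜) : EvenIso M.shift.shift M :=
  ⟨LinearEquiv.refl _ _, fun i m => by
    have h : i + 1 + 1 = i := by rw [add_assoc, CharTwo.add_self_eq_zero, add_zero]
    change m ∈ M.part i ↔ m ∈ M.part (i + 1 + 1)
    rw [h]⟩

theorem isoUpToShift_equivalence :
    Equivalence (IsoUpToShift : Supermodule.{u, v, x} 𝒜 → Supermodule.{u, v, x} 𝒜 → Prop) where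
  refl M := Or.inl ⟨EvenIso.refl M⟩
  symm := by
    rintro M N (⟨⟨e⟩⟩ | ⟨⟨e⟩⟩)
    · exact Or.inl ⟨e.symm⟩
    · exact Or.inr ⟨(e.shift.trans N.shiftShift).symm⟩
  trans := by
    rintro M N P (⟨⟨e⟩⟩ | ⟨⟨e⟩⟩) (⟨⟨f⟩⟩ | ⟨⟨f⟩⟩)
    · exact Or.inl ⟨e.trans f⟩
    · exact Or.inr ⟨e.trans f⟩
    · exact Or.inr ⟨e.trans f.shift⟩
    · exact Or.inl ⟨(e.trans f.shift).trans P.shiftShift⟩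

variable (𝒜) in
/-- Isomorphism up to parity shift, on irreducible supermodules. -/
def irredSetoid : Setoid {M : Supermodule.{u, v, x} 𝒜 // M.IsIrreducible} :=
  Setoid.comap Subtype.val ⟨IsoUpToShift, isoUpToShift_equivalence⟩

variable (𝒜) in
/-- The isomorphism classes, up to parity shift, of irreducible right supermodules. -/
def IrredClass : Type _ := Quotient (irredSetoid.{u, v, x} 𝒜)

theorem IsSelfAssociate.of_isoUpToShift {M N : Supermodule.{u, v, x} 𝒜}
    (h : IsoUpToShift M N) (hM : IsSelfAssociate M) : IsSelfAssociate N := by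
  obtain ⟨s⟩ := hM
  rcases h with ⟨⟨e⟩⟩ | ⟨⟨e⟩⟩
  · exact ⟨e.symm.trans (s.trans e.shift)⟩
  · exact ⟨N.shiftShift.symm.trans (e.symm.shift.trans (s.symm.trans e))⟩

/-- The class consists of self-associate supermodules. -/
def IrredClass.IsSelfAssociate (q : IrredClass.{u, v, x} 𝒜) : Prop :=
  Quotient.lift (s := irredSetoid.{u, v, x} 𝒜) (fun M => M.1.IsSelfAssociate)
    (fun _ _ h => propext ⟨Supermodule.IsSelfAssociate.of_isoUpToShift h,
      Supermodule.IsSelfAssociate.of_isoUpToShift (isoUpToShift_equivalence.symm h)⟩) q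

end Supermodule

end Supermodules

end

/-! ### Signs, and eigenspaces of an automorphism on the centre -/

noncomputable section

/-! Write `A` for the twisted group algebra and `σ` for its parity automorphism. Both counts are
obtained by computing the dimensions of the `±1`-eigenspaces of `σ` on the ordinary centre of `A` in
two ways.

On the group side, an element is central iff its coefficients transform along conjugacy classes by
the scalars `conjFactor`. Such a function vanishes off the `c`-regular classes and is free on a
representative of each regular one. Hence the eigenspaces have as dimensions the numbers of even and
of odd regular classes (`TwistedGroupAlgebra.finrank_signedCenter`).

On the module side, `A` is semisimple and `k` is algebraically closed, so the centre is the algebra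
of functions on the set `ι` of simple modules. Twisting by `σ` induces an involution `π` of `ι`, and
`σ` acts on functions through `π`. The `+1`-eigenspace has dimension the number of orbits, the
`-1`-eigenspace the number of two-element orbits (`SimpleSystem.finrank_signedCenter`).

Irreducible supermodules up to shift correspond to the orbits of `π`
(`Supermodule.exists_bijective_irredClass`). A grading is the same as an involution semilinear over
the twist. A fixed simple module carries one by Schur's lemma and is then not self-associate; a pair
of swapped simple modules gives their direct sum with the swap, which is self-associate. -/

theorem ZMod.two_eq_zero_or_one (i : ZMod 2) : i = 0 ∨ i = 1 := by
  revert i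
  decide

/-- The sign `(-1)^i`. -/
def paritySign (k : Type u) [Field k] (i : ZMod 2) : k := if i = 0 then 1 else -1

section ParitySign

variable (k : Type u) [Field k]

@[simp] theorem paritySign_zero : paritySign k 0 = 1 := by simp [paritySign]

@[simp] theorem paritySign_one : paritySign k 1 = -1 := by simp [paritySign]

theorem paritySign_add (i j : ZMod 2) :
    paritySign k (i + j) = paritySign k i * paritySign k j := by
  have h : (1 + 1 : ZMod 2) = 0 := rfl
  rcases ZMod.two_eq_zero_or_one i with rfl | rfl <;>
    rcases ZMod.two_eq_zero_or_one j with rfl | rfl <;> simp [h]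

theorem paritySign_mul_self (i : ZMod 2) : paritySign k i * paritySign k i = 1 := by
  rcases ZMod.two_eq_zero_or_one i with rfl | rfl <;> simp

theorem paritySign_injective [CharZero k] : Function.Injective (paritySign k) := by
  have h1 : (1 : k) ≠ -1 := by norm_num [eq_neg_iff_add_eq_zero]
  intro i j h
  rcases ZMod.two_eq_zero_or_one i with rfl | rfl <;>
    rcases ZMod.two_eq_zero_or_one j with rfl | rfl <;> simp_all [eq_comm]

end ParitySign

/-- The central elements of `R` on which the automorphism `τ` acts by the scalar `ε`. -/
def signedCenter {k : Type u} [Field k] {R : Type v} [Ring R] [Algebra k R] (τ : R ≃ₐ[k] R)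
    (ε : k) : Submodule k R where
  carrier := {r | (∀ b, r * b = b * r) ∧ τ r = ε • r}
  zero_mem' := by simp
  add_mem' := by
    rintro a b ⟨ha, ha'⟩ ⟨hb, hb'⟩
    exact ⟨fun d => by rw [add_mul, mul_add, ha, hb], by rw [map_add, ha', hb', smul_add]⟩
  smul_mem' := by
    rintro r a ⟨ha, ha'⟩
    exact ⟨fun d => by rw [smul_mul_assoc, mul_smul_comm, ha],
      by rw [map_smul, ha', smul_comm]⟩

theorem mem_signedCenter {k : Type u} [Field k] {R : Type v} [Ring R] [Algebra k R]
    {τ : R ≃ₐ[k] R} {ε : k} {r : R} :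
    r ∈ signedCenter τ ε ↔ (∀ b, r * b = b * r) ∧ τ r = ε • r := Iff.rfl

/-- Passing to the opposite algebra does not change the signed center. -/
def signedCenterOpEquiv {k : Type u} [Field k] {R : Type v} [Ring R] [Algebra k R]
    (τ : R ≃ₐ[k] R) (ε : k) : signedCenter τ ε ≃ₗ[k] signedCenter (AlgEquiv.op τ) ε where
  toFun r := ⟨MulOpposite.op r.1, fun b => by
      rw [← MulOpposite.op_unop b, ← MulOpposite.op_mul, ← MulOpposite.op_mul, r.2.1],
    by simp [r.2.2]⟩
  invFun r := ⟨MulOpposite.unop r.1, fun b => by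
      rw [← MulOpposite.unop_op b, ← MulOpposite.unop_mul, ← MulOpposite.unop_mul, r.2.1],
    by
      have h := congrArg MulOpposite.unop r.2.2
      simpa using h⟩
  map_add' _ _ := rfl
  map_smul' _ _ := rfl
  left_inv _ := rfl
  right_inv _ := rfl

/-! ### Conjugation scalars of a cocycle -/

namespace TwoCocycle

variable {G : Type v} [Group G] {k : Type u} [Field k] (c : TwoCocycle G k)

/-- The scalar `λ` with `e_h e_g = λ e_{hgh⁻¹} e_h`. -/
def conjFactor (h g : G) : kˣ := c h g / c (h * g * h⁻¹) h

/-- Up to a scalar, conjugation by `e_{h'h}` is conjugation by `e_h` followed by conjugation by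
`e_{h'}`. -/
theorem conjFactor_mul (h' h g : G) :
    c.conjFactor (h' * h) g = c.conjFactor h' (h * g * h⁻¹) * c.conjFactor h g := by
  have e1 := c.cocycle h' h g
  have e2 := c.cocycle h' (h * g * h⁻¹) h
  have e3 := c.cocycle (h' * (h * g * h⁻¹) * h'⁻¹) h' h
  have e4 : h' * h * g * (h' * h)⁻¹ = h' * (h * g * h⁻¹) * h'⁻¹ := by group
  rw [inv_mul_cancel_right] at e2 e3
  unfold conjFactor
  rw [e4, ← mul_div_mul_comm, div_eq_div_iff_mul_eq_mul]
  -- With these two extra factors the cocycle relations for `(h', h, g)`, `(h', hgh⁻¹, h)` and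
  -- `(h'hgh⁻¹h'⁻¹, h', h)` become applicable.
  refine mul_left_cancel (a := c h' h * c (h' * (h * g * h⁻¹)) h) ?_
  calc _ = (c h' h * c (h' * h) g) * c (h' * (h * g * h⁻¹)) h *
        (c (h' * (h * g * h⁻¹) * h'⁻¹) h' * c (h * g * h⁻¹) h) := by ac_rfl
    _ = (c h g * (c (h * g * h⁻¹) h * c h' (h * g))) *
        (c (h' * (h * g * h⁻¹) * h'⁻¹) h' * c (h' * (h * g * h⁻¹)) h) := by rw [e1]; ac_rfl
    _ = _ := by rw [← e2, e3]; ac_rfl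

theorem conjFactor_eq_one_iff {h g : G} (hg : h * g * h⁻¹ = g) :
    c.conjFactor h g = 1 ↔ c g h = c h g := by
  rw [conjFactor, hg, div_eq_one, eq_comm]

/-- The two conjugating elements differ by an element of the centralizer of `g`, whose factor is `1`
by regularity. -/
theorem conjFactor_congr {g : G} (hr : c.IsRegular (ConjClasses.mk g)) {h h' : G}
    (hh : h * g * h⁻¹ = h' * g * h'⁻¹) : c.conjFactor h g = c.conjFactor h' g := by
  have hz : (h'⁻¹ * h) * g * (h'⁻¹ * h)⁻¹ = g := by
    calc _ = h'⁻¹ * (h * g * h⁻¹) * h' := by group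
      _ = g := by rw [hh]; group
  have h1 : c.conjFactor (h'⁻¹ * h) g = 1 := by
    rw [c.conjFactor_eq_one_iff hz]
    refine hr g ConjClasses.mem_carrier_mk _ ?_
    rw [Subgroup.mem_centralizer_singleton_iff]
    exact mul_inv_eq_iff_eq_mul.1 hz
  have h2 := c.conjFactor_mul h' (h'⁻¹ * h) g
  rwa [hz, h1, mul_one, mul_inv_cancel_left] at h2

end TwoCocycle

/-! ### The centre of the twisted group algebra and its parity automorphism -/

namespace TwistedGroupAlgebra

variable {G : Type v} [Group G] {k : Type u} [Field k] (c : TwoCocycle G k)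

theorem repr_basis_mul (h : G) (a : TwistedGroupAlgebra c) (g : G) :
    (basis c).repr (basis c h * a) (h * g) = c h g * (basis c).repr a g := by
  classical
  induction a using TwistedGroupAlgebra.induction with
  | h0 => simp
  | hadd a b ha hb => simp [mul_add, ha, hb]
  | hs r x =>
    rw [mul_smul_comm, basis_mul_basis]
    by_cases hx : x = g
    · subst hx; simp [mul_comm]
    · simp [hx]

theorem repr_mul_basis (h : G) (a : TwistedGroupAlgebra c) (g : G) :
    (basis c).repr (a * basis c h) (g * h) = c g h * (basis c).repr a g := by
  classical
  induction a using TwistedGroupAlgebra.induction with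
  | h0 => simp
  | hadd a b ha hb => simp [mul_add, add_mul, ha, hb]
  | hs r x =>
    rw [smul_mul_assoc, basis_mul_basis]
    by_cases hx : x = g
    · subst hx; simp [mul_comm]
    · simp [hx]

/-- Compare the coefficients of `e_{hg}` in `a e_h` and in `e_h a`. -/
theorem forall_commute_iff (a : TwistedGroupAlgebra c) :
    (∀ b, a * b = b * a) ↔
      ∀ h g, (basis c).repr a (h * g * h⁻¹) = c.conjFactor h g * (basis c).repr a g := by
  have key : ∀ h g, ((basis c).repr (a * basis c h) (h * g) =
      (basis c).repr (basis c h * a) (h * g) ↔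
      (basis c).repr a (h * g * h⁻¹) = c.conjFactor h g * (basis c).repr a g) := by
    intro h g
    have h1 := repr_mul_basis c h a (h * g * h⁻¹)
    rw [inv_mul_cancel_right] at h1
    rw [h1, repr_basis_mul, TwoCocycle.conjFactor, Units.val_div_eq_div_val]
    have h2 := (c (h * g * h⁻¹) h).ne_zero
    field_simp
  constructor
  · intro H h g
    rw [← key, H]
  · intro H b
    induction b using TwistedGroupAlgebra.induction with
    | h0 => simp
    | hadd b b' hb hb' => rw [mul_add, add_mul, hb, hb']
    | hs r h =>
      rw [mul_smul_comm, smul_mul_assoc]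
      congr 1
      refine (basis c).repr.injective (Finsupp.ext fun x => ?_)
      have := (key h (h⁻¹ * x)).2 (H _ _)
      rwa [mul_inv_cancel_left] at this

section Parity

variable (deg : G →* Multiplicative (ZMod 2))

/-- The linear map `e_g ↦ (-1)^{deg g} e_g`. -/
def parityLin : TwistedGroupAlgebra c →ₗ[k] TwistedGroupAlgebra c :=
  (basis c).constr k fun g => paritySign k (deg g).toAdd • basis c g

@[simp] theorem parityLin_basis (g : G) :
    parityLin c deg (basis c g) = paritySign k (deg g).toAdd • basis c g := by
  simp [parityLin]

/-- The parity automorphism `e_g ↦ (-1)^{deg g} e_g`. -/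
def parityHom : TwistedGroupAlgebra c →ₐ[k] TwistedGroupAlgebra c :=
  AlgHom.ofLinearMap (parityLin c deg) (by simp [one_def]) (by
    intro a b
    induction a using TwistedGroupAlgebra.induction with
    | h0 => simp
    | hadd a a' h h' => rw [add_mul, map_add, h, h', map_add, add_mul]
    | hs r g =>
    induction b using TwistedGroupAlgebra.induction with
    | h0 => simp
    | hadd a a' h h' => rw [mul_add, map_add, h, h', map_add, mul_add]
    | hs s h =>
    simp only [map_smul, smul_mul_assoc, mul_smul_comm, basis_mul_basis, parityLin_basis, map_mul,
      toAdd_mul, paritySign_add, smul_smul]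
    congr 1
    ring)

@[simp] theorem parityHom_basis (g : G) :
    parityHom c deg (basis c g) = paritySign k (deg g).toAdd • basis c g :=
  parityLin_basis c deg g

theorem parityHom_parityHom (a : TwistedGroupAlgebra c) :
    parityHom c deg (parityHom c deg a) = a := by
  induction a using TwistedGroupAlgebra.induction with
  | h0 => simp
  | hadd a a' h h' => rw [map_add, map_add, h, h']
  | hs r g => simp [smul_smul, mul_assoc, paritySign_mul_self]

/-- The parity automorphism as an equivalence. -/
def parityEquiv : TwistedGroupAlgebra c ≃ₐ[k] TwistedGroupAlgebra c :=
  AlgEquiv.ofAlgHom (parityHom c deg) (parityHom c deg)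
    (AlgHom.ext (parityHom_parityHom c deg)) (AlgHom.ext (parityHom_parityHom c deg))

@[simp] theorem parityEquiv_basis (g : G) :
    parityEquiv c deg (basis c g) = paritySign k (deg g).toAdd • basis c g :=
  parityLin_basis c deg g

theorem parityEquiv_parityEquiv (a : TwistedGroupAlgebra c) :
    parityEquiv c deg (parityEquiv c deg a) = a := parityHom_parityHom c deg a

theorem parityEquiv_of_mem {i : ZMod 2} {a : TwistedGroupAlgebra c} (ha : a ∈ grading c deg i) :
    parityEquiv c deg a = paritySign k i • a := by
  induction ha using Submodule.span_induction with
  | zero => simp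
  | add x y _ _ hx hy => rw [map_add, hx, hy, smul_add]
  | smul r x _ hx => rw [map_smul, hx, smul_comm]
  | mem x hx =>
    obtain ⟨g, rfl, rfl⟩ := hx
    simp

theorem repr_parityEquiv (a : TwistedGroupAlgebra c) (g : G) :
    (basis c).repr (parityEquiv c deg a) g =
      paritySign k (deg g).toAdd * (basis c).repr a g := by
  classical
  induction a using TwistedGroupAlgebra.induction with
  | h0 => simp
  | hadd a b ha hb => simp [mul_add, ha, hb]
  | hs r x =>
    by_cases hx : x = g
    · subst hx; simp [mul_comm]
    · simp [hx]

theorem mem_signedCenter_iff (ε : k) (a : TwistedGroupAlgebra c) :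
    a ∈ signedCenter (parityEquiv c deg) ε ↔
      (∀ h g, (basis c).repr a (h * g * h⁻¹) = c.conjFactor h g * (basis c).repr a g) ∧
      ∀ g, paritySign k (deg g).toAdd * (basis c).repr a g = ε * (basis c).repr a g := by
  rw [mem_signedCenter, forall_commute_iff]
  refine and_congr_right fun _ => ?_
  rw [← (basis c).repr.injective.eq_iff, Finsupp.ext_iff]
  simp [repr_parityEquiv]

end Parity

/-! ### Central elements of given degree and regular classes -/

section Counting

variable (deg : G →* Multiplicative (ZMod 2)) (i : ZMod 2)

theorem hasDegree_mk_iff (g : G) :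
    ConjClassHasDegree deg (ConjClasses.mk g) i ↔ (deg g).toAdd = i := by
  refine ⟨fun h => h g ConjClasses.mem_carrier_mk, fun h x hx => ?_⟩
  rw [ConjClasses.mem_carrier_iff_mk_eq, ConjClasses.mk_eq_mk_iff_isConj, isConj_iff] at hx
  obtain ⟨d, rfl⟩ := hx
  rw [← h, map_mul deg, map_mul deg, map_inv deg, mul_inv_cancel_comm]

/-- Evaluation of a central element of degree `i` at representatives of the regular conjugacy
classes of degree `i`. -/
def centerEval : signedCenter (parityEquiv c deg) (paritySign k i) →ₗ[k]
    ({C : ConjClasses G // ConjClassHasDegree deg C i ∧ c.IsRegular C} → k) :=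
  LinearMap.pi fun C => (Finsupp.lapply (Quotient.out C.1)) ∘ₗ
    (basis c).repr.toLinearMap ∘ₗ Submodule.subtype _

/-- A central element is determined on a class by one coefficient. On a non-regular class some
centralizing `h` has factor different from `1`, which forces that coefficient to vanish; in the
wrong degree the sign does. -/
theorem centerEval_injective [CharZero k] : Function.Injective (centerEval c deg i) := by
  rw [injective_iff_map_eq_zero]
  rintro ⟨a, ha⟩ h0
  rw [mem_signedCenter_iff] at ha
  obtain ⟨h1, h2⟩ := ha
  have hconj : ∀ g g', IsConj g g' → (basis c).repr a g = 0 → (basis c).repr a g' = 0 := by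
    intro g g' hg h
    obtain ⟨d, rfl⟩ := isConj_iff.1 hg
    rw [h1, h, mul_zero]
  refine Subtype.ext ((basis c).repr.injective (Finsupp.ext fun g => ?_))
  change (basis c).repr a g = (basis c).repr 0 g
  rw [map_zero, Finsupp.zero_apply]
  by_cases hdeg : (deg g).toAdd = i
  · by_cases hreg : c.IsRegular (ConjClasses.mk g)
    · have h := congrFun h0 ⟨ConjClasses.mk g, (hasDegree_mk_iff deg i g).2 hdeg, hreg⟩
      refine hconj _ _ ?_ h
      rw [← ConjClasses.mk_eq_mk_iff_isConj]
      exact Quotient.out_eq _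
    · unfold TwoCocycle.IsRegular at hreg
      push Not at hreg
      obtain ⟨x, hx, h, hh, hne⟩ := hreg
      rw [ConjClasses.mem_carrier_iff_mk_eq, ConjClasses.mk_eq_mk_iff_isConj] at hx
      refine hconj x g hx ?_
      rw [Subgroup.mem_centralizer_singleton_iff] at hh
      have hx' : h * x * h⁻¹ = x := mul_inv_eq_iff_eq_mul.2 hh
      have h3 := h1 h x
      rw [hx'] at h3
      by_contra h4
      refine hne ((c.conjFactor_eq_one_iff hx').1 (Units.ext ?_))
      exact (right_eq_mul₀ h4).1 h3
  · by_contra h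
    exact hdeg (paritySign_injective k (mul_right_cancel₀ h (h2 g)))

/-- Prescribed values at the representatives are spread over each class by `conjFactor`; regularity
makes this independent of the conjugating elements `t g`. -/
theorem centerEval_surjective [Finite G] : Function.Surjective (centerEval c deg i) := by
  classical
  intro v
  have := Fintype.ofFinite G
  have hex : ∀ g : G, ∃ h : G, h * Quotient.out (ConjClasses.mk g) * h⁻¹ = g := fun g => by
    rw [← isConj_iff, ← ConjClasses.mk_eq_mk_iff_isConj]
    exact Quotient.out_eq _
  choose t ht using hex
  let v' : ConjClasses G → k := fun C =>
    if hC : ConjClassHasDegree deg C i ∧ c.IsRegular C then v ⟨C, hC⟩ else 0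
  let f : G → k := fun g =>
    c.conjFactor (t g) (Quotient.out (ConjClasses.mk g)) * v' (ConjClasses.mk g)
  have hf : ∀ g, (basis c).repr ((basis c).equivFun.symm f) g = f g := fun g => by
    rw [← Module.Basis.equivFun_apply, LinearEquiv.apply_symm_apply]
  have hreg : ∀ C : ConjClasses G, c.IsRegular C →
      c.IsRegular (ConjClasses.mk (Quotient.out C)) := fun C hC => by
    rwa [show ConjClasses.mk (Quotient.out C) = C from Quotient.out_eq C]
  refine ⟨⟨(basis c).equivFun.symm f, ?_⟩, ?_⟩
  · rw [mem_signedCenter_iff]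
    simp only [hf]
    refine ⟨fun h g => ?_, fun g => ?_⟩
    · have hm : ConjClasses.mk (h * g * h⁻¹) = ConjClasses.mk g := by
        rw [eq_comm, ConjClasses.mk_eq_mk_iff_isConj, isConj_iff]
        exact ⟨h, rfl⟩
      have ht' := ht (h * g * h⁻¹)
      simp only [f]
      rw [hm] at ht' ⊢
      by_cases hC : ConjClassHasDegree deg (ConjClasses.mk g) i ∧ c.IsRegular (ConjClasses.mk g)
      · rw [← mul_assoc, ← Units.val_mul]
        congr 2
        -- Both `h * t g` and `t (h * g * h⁻¹)` conjugate the representative to `h * g * h⁻¹`.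
        have h1 := c.conjFactor_mul h (t g) (Quotient.out (ConjClasses.mk g))
        rw [ht] at h1
        rw [← h1]
        refine c.conjFactor_congr (hreg _ hC.2) (ht'.trans ?_)
        conv_lhs => rw [← ht g]
        group
      · simp [v', hC]
    · by_cases hC : ConjClassHasDegree deg (ConjClasses.mk g) i ∧ c.IsRegular (ConjClasses.mk g)
      · rw [(hasDegree_mk_iff deg i g).1 hC.1]
      · simp [f, v', hC]
  · funext C
    change (basis c).repr ((basis c).equivFun.symm f) (Quotient.out C.1) = _
    have hC : ConjClasses.mk (Quotient.out C.1) = C.1 := Quotient.out_eq C.1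
    have ht' := ht (Quotient.out C.1)
    rw [hf]
    simp only [f]
    rw [hC] at ht' ⊢
    -- The element chosen for the representative itself need not be `1`, but it centralizes the
    -- representative.
    have h1 : c.conjFactor (t (Quotient.out C.1)) (Quotient.out C.1) = 1 := by
      rw [c.conjFactor_eq_one_iff ht']
      refine C.2.2 _ ?_ _ ?_
      · rw [ConjClasses.mem_carrier_iff_mk_eq, hC]
      · rw [Subgroup.mem_centralizer_singleton_iff]
        exact mul_inv_eq_iff_eq_mul.1 ht'
    rw [h1]
    simp [v', C.2]

theorem finrank_signedCenter [Finite G] [CharZero k] :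
    Module.finrank k (signedCenter (parityEquiv c deg) (paritySign k i)) =
      Nat.card {C : ConjClasses G // ConjClassHasDegree deg C i ∧ c.IsRegular C} := by
  have := Fintype.ofFinite {C : ConjClasses G // ConjClassHasDegree deg C i ∧ c.IsRegular C}
  rw [(LinearEquiv.ofBijective _ ⟨centerEval_injective c deg i,
    centerEval_surjective c deg i⟩).finrank_eq, Module.finrank_fintype_fun_eq_card,
    Nat.card_eq_fintype_card]

end Counting

/-! ### Semisimplicity by the trace form -/

section Semisimple

variable [Finite G]

instance : Module.Finite k (TwistedGroupAlgebra c) := Module.Finite.of_basis (basis c)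

/-- Every diagonal entry in the basis `e_g` is the same. The factor `c 1 1` appears because the
cocycle need not be normalized. -/
theorem trace_mulLeft (a : TwistedGroupAlgebra c) :
    LinearMap.trace k _ (LinearMap.mulLeft k a) =
      Nat.card G * (c 1 1 * (basis c).repr a 1) := by
  classical
  have := Fintype.ofFinite G
  rw [LinearMap.trace_eq_matrix_trace k (basis c), Matrix.trace, Nat.card_eq_fintype_card]
  have h : ∀ g, (LinearMap.toMatrix (basis c) (basis c) (LinearMap.mulLeft k a)).diag g =
      c 1 1 * (basis c).repr a 1 := by
    intro g
    have h1 := repr_mul_basis c g a 1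
    rw [one_mul, c.one_left] at h1
    rw [Matrix.diag_apply, LinearMap.toMatrix_apply, LinearMap.mulLeft_apply, h1]
  rw [Finset.sum_congr rfl fun g _ => h g]
  simp

/-- Elements of the Jacobson radical are nilpotent, hence have trace zero, and so no `e_1`
coefficient in characteristic zero. Multiplying by `e_{g⁻¹}` moves any other coefficient to that
place. -/
instance isSemisimpleRing [CharZero k] : IsSemisimpleRing (TwistedGroupAlgebra c) := by
  have hA : IsArtinianRing (TwistedGroupAlgebra c) := IsArtinianRing.of_finite k _
  rw [IsArtinianRing.isSemisimpleRing_iff_jacobson, eq_bot_iff]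
  intro a ha
  obtain ⟨n, hn⟩ := IsSemiprimaryRing.isNilpotent (R := TwistedGroupAlgebra c)
  have hnil : ∀ b ∈ Ring.jacobson (TwistedGroupAlgebra c), (basis c).repr b 1 = 0 := by
    intro b hb
    have h1 : b ^ n = 0 := by
      have := Ideal.pow_mem_pow hb n
      rwa [hn] at this
    have h2 := LinearMap.isNilpotent_trace_of_isNilpotent (f := LinearMap.mulLeft k b)
      ⟨n, by rw [LinearMap.pow_mulLeft, h1, LinearMap.mulLeft_zero_eq_zero]⟩
    rw [trace_mulLeft, isNilpotent_iff_eq_zero] at h2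
    have := Nat.card_pos (α := G)
    simpa [this.ne'] using h2
  refine (basis c).repr.injective (Finsupp.ext fun g => ?_)
  have h3 := hnil (basis c g⁻¹ * a) (Ideal.mul_mem_left _ _ ha)
  have h4 := repr_basis_mul c g⁻¹ a g
  rw [inv_mul_cancel, h3, eq_comm] at h4
  simpa using h4

end Semisimple

end TwistedGroupAlgebra

/-! ### Schur's lemma and twisted modules -/

section Schur

variable {k : Type u} [Field k] [IsAlgClosed k] {R : Type v} [Ring R] {S : Type x}
  [AddCommGroup S] [Module k S] [Module R S] [IsSimpleModule R S] [Module.Finite k S]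

/-- **Schur's lemma**: a `k`-linear endomorphism of a finite-dimensional simple module that
commutes with the action is a scalar. -/
theorem IsSimpleModule.exists_eq_smul_of_commute [SMulCommClass k R S] (f : S →ₗ[k] S)
    (hf : ∀ (r : R) v, f (r • v) = r • f v) : ∃ μ : k, ∀ v, f v = μ • v := by
  have := IsSimpleModule.nontrivial R S
  obtain ⟨μ, hμ⟩ := Module.End.exists_eigenvalue f
  obtain ⟨v, hv⟩ := hμ.exists_hasEigenvector
  let g : S →ₗ[R] S :=
    { toFun := fun v => f v - μ • v
      map_add' := fun a b => by rw [map_add, smul_add]; abel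
      map_smul' := fun r a => by rw [hf, smul_comm μ r a, RingHom.id_apply, smul_sub] }
  refine ⟨μ, fun w => ?_⟩
  rcases g.injective_or_eq_zero with h | h
  · refine (hv.2 (h ?_)).elim
    rw [map_zero]
    change f v - μ • v = 0
    rw [hv.apply_eq_smul, sub_self]
  · exact sub_eq_zero.1 (LinearMap.congr_fun h w)

end Schur

section Twist

variable {k : Type u} [Field k] {R : Type v} [Ring R] [Algebra k R]

/-- The module `M` with the action of `R` twisted by the automorphism `τ`. -/
def Twist (_τ : R ≃ₐ[k] R) (M : Type x) : Type x := M

namespace Twist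

variable (τ : R ≃ₐ[k] R) (M : Type x) [AddCommGroup M] [Module R M]

instance : AddCommGroup (Twist τ M) := inferInstanceAs (AddCommGroup M)

instance : Module R (Twist τ M) := Module.compHom M (τ : R →+* R)

/-- The identity, as a semilinear map. -/
def toBase : Twist τ M →ₛₗ[(τ : R →+* R)] M where
  toFun := id
  map_add' _ _ := rfl
  map_smul' _ _ := rfl

instance [IsSimpleModule R M] : IsSimpleModule R (Twist τ M) := by
  have : RingHomSurjective (τ : R →+* R) := ⟨τ.surjective⟩
  exact ((toBase τ M).isSimpleModule_iff_of_bijective Function.bijective_id).2 inferInstance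

end Twist

end Twist

/-- A complete system of simple modules of a split semisimple algebra, with the central elements
that act on them by prescribed scalars. -/
structure SimpleSystem (k : Type u) [Field k] (R : Type v) [Ring R] [Algebra k R] {ι : Type}
    (S : ι → Type x) [∀ i, AddCommGroup (S i)] [∀ i, Module k (S i)] [∀ i, Module R (S i)] where
  simple : ∀ i, IsSimpleModule R (S i)
  finite : ∀ i, Module.Finite k (S i)
  exists_equiv : ∀ (M : Type x) [AddCommGroup M] [Module R M] [IsSimpleModule R M],
    ∃ i, Nonempty (S i ≃ₗ[R] M)
  /-- The central element that acts on `S i` by the scalar `f i`. -/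
  ofChar : (ι → k) →ₗ[k] R
  ofChar_comm : ∀ f b, ofChar f * b = b * ofChar f
  ofChar_smul : ∀ f i (v : S i), ofChar f • v = f i • v
  eq_zero : ∀ r : R, (∀ i (v : S i), r • v = 0) → r = 0

/-! ### Simple modules of a product of matrix algebras -/

section Column

variable {k : Type u} [Field k] {R : Type v} [Ring R] [Algebra k R] {ι : Type} {d : ι → ℕ}
  (Φ : R ≃ₐ[k] Π i, Matrix (Fin (d i)) (Fin (d i)) k)

/-- The module of column vectors of the `i`-th block. -/
def ColumnModule (_Φ : R ≃ₐ[k] Π i, Matrix (Fin (d i)) (Fin (d i)) k) (i : ι) :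
    Type (max u w) := ULift.{w} (Fin (d i) → k)

namespace ColumnModule

variable (i : ι)

instance : AddCommGroup (ColumnModule.{u, v, w} Φ i) :=
  inferInstanceAs (AddCommGroup (ULift (Fin (d i) → k)))

instance : Module k (ColumnModule.{u, v, w} Φ i) :=
  inferInstanceAs (Module k (ULift (Fin (d i) → k)))

/-- The underlying column vector. -/
def toFun : ColumnModule.{u, v, w} Φ i ≃ₗ[k] (Fin (d i) → k) := ULift.moduleEquiv

instance : Module.Finite k (ColumnModule.{u, v, w} Φ i) :=
  Module.Finite.equiv (toFun Φ i).symm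

instance : SMul R (ColumnModule.{u, v, w} Φ i) :=
  ⟨fun r v => (toFun Φ i).symm ((Φ r i).mulVec (toFun Φ i v))⟩

theorem toFun_smul (r : R) (v : ColumnModule.{u, v, w} Φ i) :
    toFun Φ i (r • v) = (Φ r i).mulVec (toFun Φ i v) :=
  (toFun Φ i).apply_symm_apply _

instance : Module R (ColumnModule.{u, v, w} Φ i) where
  one_smul v := (toFun Φ i).injective (by simp [toFun_smul])
  mul_smul r s v := (toFun Φ i).injective (by simp [toFun_smul])
  smul_zero r := (toFun Φ i).injective (by simp [toFun_smul])
  smul_add r v w := (toFun Φ i).injective (by simp [toFun_smul, Matrix.mulVec_add])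
  add_smul r s v := (toFun Φ i).injective (by simp [toFun_smul, Matrix.add_mulVec])
  zero_smul v := (toFun Φ i).injective (by simp [toFun_smul])

instance : IsScalarTower k R (ColumnModule.{u, v, w} Φ i) :=
  ⟨fun r s v => (toFun Φ i).injective (by simp [toFun_smul, Matrix.smul_mulVec])⟩

/-- The element of `R` whose `i`-th block has the column `v` at `j`, and zeros elsewhere. -/
def single [DecidableEq ι] (j : Fin (d i)) : ColumnModule.{u, v, w} Φ i →ₗ[R] R where
  toFun v := Φ.symm (Pi.single i (Matrix.of fun a b => if b = j then toFun Φ i v a else 0))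
  map_add' v w := by
    rw [← map_add, ← Pi.single_add]
    congr 2
    ext a b
    by_cases h : b = j <;> simp [h]
  map_smul' r v := by
    apply Φ.injective
    rw [RingHom.id_apply, smul_eq_mul, map_mul, AlgEquiv.apply_symm_apply,
      AlgEquiv.apply_symm_apply]
    funext l
    by_cases hl : l = i
    · subst hl
      ext a b
      rw [Pi.mul_apply, Pi.single_eq_same, Pi.single_eq_same, Matrix.mul_apply]
      by_cases h : b = j <;> simp [h, toFun_smul, Matrix.mulVec, dotProduct]
    · simp [hl]

/-- The summands are the diagonal matrix units of all blocks. -/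
theorem sum_single [Fintype ι] [DecidableEq ι] :
    ∑ i, ∑ j, single Φ i j ((toFun.{u, v, w} Φ i).symm (Pi.single j 1)) = 1 := by
  apply Φ.injective
  rw [map_sum, map_one]
  funext l
  rw [Finset.sum_apply, Finset.sum_eq_single l]
  · rw [map_sum, Finset.sum_apply]
    ext a b
    simp [single, Matrix.sum_apply, Pi.single_apply, Matrix.one_apply]
  · intro i _ hi
    simp [single, hi.symm]
  · simp

theorem exists_single_smul_ne_zero [Fintype ι] [DecidableEq ι] {M : Type x} [AddCommGroup M]
    [Module R M] {m : M} (hm : m ≠ 0) :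
    ∃ (i : ι) (j : Fin (d i)) (v : ColumnModule.{u, v, w} Φ i), single Φ i j v • m ≠ 0 := by
  by_contra! h
  refine hm ?_
  rw [← one_smul R m, ← sum_single.{u, v, w} Φ, Finset.sum_smul]
  refine Finset.sum_eq_zero fun i _ => ?_
  rw [Finset.sum_smul]
  exact Finset.sum_eq_zero fun j _ => h i j _

theorem isSimpleModule [DecidableEq ι] (hd : NeZero (d i)) :
    IsSimpleModule R (ColumnModule.{u, v, w} Φ i) := by
  have hnt : Nontrivial (ColumnModule.{u, v, w} Φ i) := (toFun Φ i).toEquiv.nontrivial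
  rw [isSimpleModule_iff_toSpanSingleton_surjective]
  refine ⟨hnt, fun m hm w => ?_⟩
  obtain ⟨j, hj⟩ : ∃ j, toFun Φ i m j ≠ 0 := by
    by_contra! h
    exact hm ((toFun Φ i).injective (by ext j; simp [h]))
  -- The matrix with `j`-th column `w / m_j` and zeros elsewhere sends `m` to `w`.
  refine ⟨single Φ i j ((toFun Φ i m j)⁻¹ • w), (toFun Φ i).injective ?_⟩
  rw [LinearMap.toSpanSingleton_apply, toFun_smul]
  ext a
  simp [single, Matrix.mulVec, dotProduct]
  field_simp

/-- The column modules form a complete system of simple modules. -/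
def simpleSystem [Fintype ι] [DecidableEq ι] (hd : ∀ i, NeZero (d i)) :
    SimpleSystem k R (ColumnModule.{u, v, w} Φ) where
  simple i := isSimpleModule Φ i (hd i)
  finite i := inferInstance
  exists_equiv M _ _ _ := by
    have := IsSimpleModule.nontrivial R M
    obtain ⟨m, hm⟩ := exists_ne (0 : M)
    obtain ⟨i, j, v, hv⟩ := exists_single_smul_ne_zero.{u, v, w} Φ hm
    have := isSimpleModule.{u, v, w} Φ i (hd i)
    refine ⟨i, ⟨LinearEquiv.ofBijective
      ((LinearMap.toSpanSingleton R M m).comp (single Φ i j))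
      (LinearMap.bijective_of_ne_zero fun h => hv (LinearMap.congr_fun h v))⟩⟩
  ofChar := Φ.symm.toLinearMap ∘ₗ
    LinearMap.pi fun i => (Matrix.scalarAlgHom (Fin (d i)) k).toLinearMap ∘ₗ LinearMap.proj i
  ofChar_comm f b := by
    apply Φ.injective
    funext l
    simpa [Matrix.scalar_apply] using (Matrix.scalar_commute (f l) (Commute.all _) (Φ b l)).eq
  ofChar_smul f i v := by
    apply (toFun Φ i).injective
    rw [toFun_smul]
    ext a
    simp [Matrix.scalar_apply, Matrix.mulVec_diagonal]
  eq_zero r h := by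
    apply Φ.injective
    funext i
    refine Matrix.ext_of_mulVec_single fun j => ?_
    have h1 := congrArg (toFun Φ i) (h i ((toFun Φ i).symm (Pi.single j 1)))
    rw [toFun_smul, LinearEquiv.apply_symm_apply, map_zero] at h1
    rw [h1, map_zero, Pi.zero_apply, Matrix.zero_mulVec]

end ColumnModule

end Column

/-! ### The permutation of the simple modules induced by an involution -/

namespace SimpleSystem

variable {k : Type u} [Field k] {R : Type v} [Ring R] [Algebra k R] {ι : Type}
  {S : ι → Type x} [∀ i, AddCommGroup (S i)] [∀ i, Module k (S i)] [∀ i, Module R (S i)]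
  (D : SimpleSystem k R S)

include D

/-- The central element with character the indicator of `i` acts as `1` on `S i` and as `0` on every
other simple module. -/
theorem eq_of_ne_zero {i j : ι} {f : S i →ₗ[R] S j} (hf : f ≠ 0) : i = j := by
  classical
  have := D.simple i
  have := D.simple j
  have hb := LinearMap.bijective_of_ne_zero hf
  have := IsSimpleModule.nontrivial R (S i)
  obtain ⟨v, hv⟩ := exists_ne (0 : S i)
  by_contra h
  have h1 := f.map_smul (D.ofChar (Pi.single i 1)) v
  rw [D.ofChar_smul, D.ofChar_smul, Pi.single_eq_same, one_smul,
    Pi.single_eq_of_ne (Ne.symm h), zero_smul] at h1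
  exact hv (hb.1 (h1.trans f.map_zero.symm))

theorem exists_submodule {M : Type x} [AddCommGroup M] [Module R M] [IsSemisimpleRing R]
    [Nontrivial M] : ∃ (i : ι) (f : S i →ₗ[R] M), f ≠ 0 := by
  obtain ⟨N, hN⟩ := IsSemisimpleModule.exists_simple_submodule R M
  obtain ⟨i, ⟨e⟩⟩ := D.exists_equiv N
  refine ⟨i, N.subtype.comp e.toLinearMap, fun h => ?_⟩
  have := IsSimpleModule.nontrivial R N
  obtain ⟨n, hn⟩ := exists_ne (0 : N)
  have h1 := LinearMap.congr_fun h (e.symm n)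
  simp at h1
  exact hn h1

theorem exists_central_char [∀ i, IsScalarTower k R (S i)] [IsAlgClosed k] {z : R} (hz : ∀ b, z * b = b * z) :
    ∃ χ : ι → k, ∀ i (v : S i), z • v = χ i • v := by
  have : ∀ i, ∃ μ : k, ∀ v : S i, z • v = μ • v := fun i => by
    have := D.simple i
    have := D.finite i
    refine IsSimpleModule.exists_eq_smul_of_commute (R := R)
      (Algebra.lsmul k k (S i) z) fun r v => ?_
    simp [smul_smul, hz]
  choose χ hχ using this
  exact ⟨χ, hχ⟩

theorem exists_semilinear [∀ i, IsScalarTower k R (S i)] (τ : R ≃ₐ[k] R) (hτ : ∀ r, τ (τ r) = r) (i : ι) :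
    ∃ (j : ι) (t : S i ≃ₗ[k] S j), ∀ (r : R) v, t (r • v) = τ r • t v := by
  have := D.simple i
  obtain ⟨j, ⟨e⟩⟩ := D.exists_equiv (Twist τ (S i))
  -- An isomorphism onto the twist of `S i` is a `τ`-semilinear map to `S i`. It is `k`-linear since
  -- `τ` fixes scalars.
  let t : S j ≃ₗ[k] S i :=
    { toFun := fun v => Twist.toBase τ (S i) (e v)
      invFun := fun v => e.symm v
      map_add' := fun v w => e.map_add v w
      map_smul' := fun r v => by
        have h := congrArg (Twist.toBase τ (S i)) (e.map_smul (algebraMap k R r) v)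
        rw [(Twist.toBase τ (S i)).map_smulₛₗ] at h
        simpa using h
      left_inv := e.left_inv
      right_inv := e.right_inv }
  have ht : ∀ (r : R) v, t (r • v) = τ r • t v := fun r v =>
    congrArg (Twist.toBase τ (S i)) (e.map_smul r v)
  refine ⟨j, t.symm, fun r v => t.injective ?_⟩
  rw [ht, hτ, LinearEquiv.apply_symm_apply, LinearEquiv.apply_symm_apply]

/-- Since `τ` is an involution, `t ∘ t` commutes with `R`, so it is a nonzero scalar `μ`; rescaling
`t` by a square root of `μ⁻¹` gives an involution. -/
theorem exists_involution [∀ i, IsScalarTower k R (S i)] [IsAlgClosed k] {τ : R ≃ₐ[k] R}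
    (hττ : ∀ r, τ (τ r) = r) {i : ι}
    {t : S i ≃ₗ[k] S i} (ht : ∀ (r : R) v, t (r • v) = τ r • t v) :
    ∃ s : S i →ₗ[k] S i, (∀ v, s (s v) = v) ∧ ∀ (r : R) v, s (r • v) = τ r • s v := by
  have := D.simple i
  have := D.finite i
  have := IsSimpleModule.nontrivial R (S i)
  obtain ⟨μ, hμ⟩ := IsSimpleModule.exists_eq_smul_of_commute (R := R)
    (t.toLinearMap ∘ₗ t.toLinearMap) fun r v => by simp [ht, hττ]
  have hμ0 : μ ≠ 0 := by
    rintro rfl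
    obtain ⟨v, hv⟩ := exists_ne (0 : S i)
    have h := hμ v
    simp [hv] at h
  obtain ⟨ν, hν⟩ := IsAlgClosed.exists_eq_mul_self μ⁻¹
  refine ⟨ν • t.toLinearMap, fun v => ?_, fun r v => ?_⟩
  · have h : t (t v) = μ • v := hμ v
    simp [h, smul_smul]
    rw [← mul_assoc, ← hν, inv_mul_cancel₀ hμ0, one_smul]
  · simp [ht, smul_comm ν]

end SimpleSystem

/-- The permutation `π` describes the action of the automorphism `τ` on the simple modules. -/
structure SimpleSystem.IsTwistedBy {k : Type u} [Field k] {R : Type v} [Ring R] [Algebra k R]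
    {ι : Type} {S : ι → Type x} [∀ i, AddCommGroup (S i)] [∀ i, Module k (S i)]
    [∀ i, Module R (S i)] (_D : SimpleSystem k R S) (τ : R ≃ₐ[k] R) (π : ι → ι) : Prop where
  apply_apply : ∀ r, τ (τ r) = r
  involutive : ∀ i, π (π i) = i
  exists_semilinear : ∀ i, ∃ t : S i ≃ₗ[k] S (π i), ∀ (r : R) v, t (r • v) = τ r • t v

namespace SimpleSystem

variable {k : Type u} [Field k] {R : Type v} [Ring R] [Algebra k R] {ι : Type}
  {S : ι → Type x} [∀ i, AddCommGroup (S i)] [∀ i, Module k (S i)] [∀ i, Module R (S i)]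
  [∀ i, IsScalarTower k R (S i)] (D : SimpleSystem k R S) {τ : R ≃ₐ[k] R} {π : ι → ι}

theorem exists_isTwistedBy (hτ : ∀ r, τ (τ r) = r) : ∃ π, D.IsTwistedBy τ π := by
  choose π t ht using D.exists_semilinear τ hτ
  refine ⟨π, hτ, fun i => ?_, fun i => ⟨t i, ht i⟩⟩
  -- Two semilinear maps compose to an honest nonzero homomorphism, so its source and target
  -- coincide.
  let f : S i →ₗ[R] S (π (π i)) :=
    { toFun := fun v => t _ (t _ v)
      map_add' := by simp
      map_smul' := fun r v => by rw [ht, ht, hτ, RingHom.id_apply] }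
  refine (D.eq_of_ne_zero (f := f) fun h => ?_).symm
  have := D.simple i
  have := IsSimpleModule.nontrivial R (S i)
  obtain ⟨v, hv⟩ := exists_ne (0 : S i)
  have h1 : t _ (t _ v) = 0 := LinearMap.congr_fun h v
  simp [hv] at h1

/-! ### Signed centres and orbits -/

section Counting

variable {D} (hD : D.IsTwistedBy τ π) {ε : k} (hε : ε * ε = 1)

/-- The extension of a function on orbit representatives of `π` to a function that is multiplied
by `ε` under `π`. -/
def extendSigned (π : ι → ι) (ε : k) (P : ι → Prop) [DecidablePred P] :
    ({i // P i} → k) →ₗ[k] (ι → k) where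
  toFun v i := if h : P i then v ⟨i, h⟩ else if h : P (π i) then ε * v ⟨π i, h⟩ else 0
  map_add' v w := by
    funext i
    by_cases h : P i <;> by_cases h' : P (π i) <;> simp [h, h', mul_add]
  map_smul' r v := by
    funext i
    by_cases h : P i <;> by_cases h' : P (π i) <;> simp [h, h', mul_left_comm]

include hD

/-- Elements are compared through their action on all `S i`; the map `t` carries the action of `τ r`
on `S i` to that of `r` on `S (π i)`. -/
theorem ofChar_mem_signedCenter {f : ι → k} (hf : ∀ i, f (π i) = ε * f i) :
    D.ofChar f ∈ signedCenter τ ε := by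
  refine ⟨D.ofChar_comm f, sub_eq_zero.1 (D.eq_zero _ fun i v => ?_)⟩
  rw [sub_smul, sub_eq_zero, smul_assoc, D.ofChar_smul]
  obtain ⟨t, ht⟩ := hD.exists_semilinear i
  apply t.injective
  rw [ht, hD.apply_apply, D.ofChar_smul, map_smul, map_smul, hf, smul_smul]

include hε

theorem char_apply {z : R} (hz : z ∈ signedCenter τ ε) {χ : ι → k}
    (hχ : ∀ i (v : S i), z • v = χ i • v) (i : ι) : χ (π i) = ε * χ i := by
  have := D.simple i
  have := IsSimpleModule.nontrivial R (S i)
  obtain ⟨v, hv⟩ := exists_ne (0 : S i)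
  obtain ⟨t, ht⟩ := hD.exists_semilinear i
  have h1 := ht z v
  rw [hz.2, smul_assoc, hχ, hχ, map_smul, smul_smul] at h1
  have h2 : t v ≠ 0 := by simpa using hv
  have h3 := smul_left_injective k h2 h1
  rw [h3, ← mul_assoc, hε, one_mul]

/-- The signed centre consists of the functions `χ` on `ι` with `χ ∘ π = ε χ`. Such a function is
free on the smaller element of each orbit, except that it vanishes at fixed points when `ε ≠ 1`. -/
theorem finrank_signedCenter [IsAlgClosed k] [Fintype ι] [LinearOrder ι] :
    Module.finrank k (signedCenter τ ε) = Nat.card {i // i ≤ π i ∧ (π i = i → ε = 1)} := by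
  classical
  set P : ι → Prop := fun i => i ≤ π i ∧ (π i = i → ε = 1) with hP
  -- Both elements of an orbit are selected only at a fixed point with `ε = 1`, where the signed
  -- relation is trivial.
  have hPP : ∀ i, P i → P (π i) → π i = i ∧ ε = 1 := fun i h h' => by
    have h1 := h'.1
    rw [hD.involutive] at h1
    have h2 := le_antisymm h1 h.1
    exact ⟨h2, h.2 h2⟩
  have hf : ∀ v i, extendSigned π ε P v (π i) = ε * extendSigned π ε P v i := by
    intro v i
    by_cases h : P i <;> by_cases h' : P (π i)
    · obtain ⟨h1, h2⟩ := hPP i h h'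
      simp only [h1, h2, one_mul]
    · simp [extendSigned, h, h', hD.involutive]
    · simp [extendSigned, h, h', ← mul_assoc, hε]
    · simp [extendSigned, h, h', hD.involutive]
  let F : ({i // P i} → k) →ₗ[k] signedCenter τ ε :=
    (D.ofChar ∘ₗ extendSigned π ε P).codRestrict _
      fun v => ofChar_mem_signedCenter hD (hf v)
  have hF : Function.Bijective F := by
    constructor
    · rw [injective_iff_map_eq_zero]
      intro v hv
      funext i
      have := D.simple i
      have := IsSimpleModule.nontrivial R (S i)
      obtain ⟨m, hm⟩ := exists_ne (0 : S i)
      have h1 : D.ofChar (extendSigned π ε P v) = 0 := congrArg Subtype.val hv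
      have h2 := D.ofChar_smul (extendSigned π ε P v) i m
      rw [h1, zero_smul, eq_comm, smul_eq_zero_iff_left hm] at h2
      simpa [extendSigned, i.2] using h2
    · intro z
      obtain ⟨χ, hχ⟩ := D.exists_central_char z.2.1
      have hχ' := char_apply hD hε z.2 hχ
      refine ⟨fun i => χ i, Subtype.ext (sub_eq_zero.1 (D.eq_zero _ fun i m => ?_))⟩
      change (D.ofChar (extendSigned π ε P fun i => χ i) - z.1) • m = 0
      rw [sub_smul, sub_eq_zero, D.ofChar_smul, hχ]
      congr 1
      have h0 : π i = i → ε ≠ 1 → χ i = 0 := fun h1 h2 => by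
        have h3 := hχ' i
        rw [h1] at h3
        by_contra h4
        exact h2 ((right_eq_mul₀ h4).1 h3)
      by_cases h : P i
      · simp [extendSigned, h]
      by_cases h' : P (π i)
      · simp [extendSigned, h, h', hχ', ← mul_assoc, hε]
      · simp only [extendSigned, LinearMap.coe_mk, AddHom.coe_mk, h, h', dite_false]
        simp only [hP, hD.involutive, not_and, Classical.not_imp] at h h'
        rcases le_total i (π i) with h1 | h1
        · exact (h0 (h h1).1 (h h1).2).symm
        · exact (h0 (h' h1).1.symm (h' h1).2).symm
  rw [← (LinearEquiv.ofBijective F hF).finrank_eq, Module.finrank_fintype_fun_eq_card,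
    Nat.card_eq_fintype_card]

end Counting

end SimpleSystem

/-! ### Gradings as parity operators -/

namespace Supermodule

variable {k : Type u} [Field k] {A : Type v} [Ring A] [Algebra k A]
  {𝒜 : ZMod 2 → Submodule k A} [GradedAlgebra 𝒜]

theorem univ_zmod_two : (Set.univ : Set (ZMod 2)) = {0, 1} := by
  ext i
  simpa using ZMod.two_eq_zero_or_one i

theorem isCompl_part (M : Supermodule.{u, v, x} 𝒜) : IsCompl (M.part 0) (M.part 1) :=
  M.isInternal.isCompl zero_ne_one univ_zmod_two

theorem exists_add_eq (M : Supermodule.{u, v, x} 𝒜) (m : M) :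
    ∃ m₀ ∈ M.part 0, ∃ m₁ ∈ M.part 1, m₀ + m₁ = m :=
  Submodule.mem_sup.1 (M.isCompl_part.sup_eq_top ▸ Submodule.mem_top)

/-- The parity operator `m₀ + m₁ ↦ m₀ - m₁`. -/
def parity (M : Supermodule.{u, v, x} 𝒜) : M →ₗ[k] M :=
  (2 : k) • (M.part 0).projection (M.part 1) M.isCompl_part - LinearMap.id

theorem parity_of_mem (M : Supermodule.{u, v, x} 𝒜) {i : ZMod 2} {m : M} (hm : m ∈ M.part i) :
    M.parity m = paritySign k i • m := by
  rcases ZMod.two_eq_zero_or_one i with rfl | rfl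
  · rw [parity, LinearMap.sub_apply, LinearMap.smul_apply, LinearMap.id_apply,
      Submodule.projection_apply_of_mem_left _ hm, two_smul, add_sub_cancel_right,
      paritySign_zero, one_smul]
  · simp [parity, Submodule.projection_apply_of_mem_right _ hm]

theorem parity_eq_of_forall_mem {B : Type w} [Add B] (M : Supermodule.{u, v, x} 𝒜) {f g : M → B}
    (hf : ∀ m n, f (m + n) = f m + f n) (hg : ∀ m n, g (m + n) = g m + g n)
    (h : ∀ i, ∀ m ∈ M.part i, f m = g m) : f = g := by
  funext m
  obtain ⟨m₀, h₀, m₁, h₁, rfl⟩ := M.exists_add_eq m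
  rw [hf, hg, h 0 _ h₀, h 1 _ h₁]

@[simp] theorem parity_parity (M : Supermodule.{u, v, x} 𝒜) (m : M) :
    M.parity (M.parity m) = m := by
  refine congrFun (M.parity_eq_of_forall_mem (f := fun m => M.parity (M.parity m)) (g := id)
    (by simp) (by simp) fun i m hm => ?_) m
  simp [M.parity_of_mem hm, smul_smul, paritySign_mul_self]

/-- As `2` is invertible, the homogeneous components are exactly the eigenspaces of the parity
operator. -/
theorem mem_part_iff [CharZero k] (M : Supermodule.{u, v, x} 𝒜) {i : ZMod 2} {m : M} :
    m ∈ M.part i ↔ M.parity m = paritySign k i • m := by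
  refine ⟨M.parity_of_mem, fun h => ?_⟩
  obtain ⟨m₀, h₀, m₁, h₁, rfl⟩ := M.exists_add_eq m
  rw [map_add, M.parity_of_mem h₀, M.parity_of_mem h₁, paritySign_zero, paritySign_one,
    one_smul, neg_one_smul] at h
  rcases ZMod.two_eq_zero_or_one i with rfl | rfl
  · have h2 : (2 : k) • m₁ = 0 := by
      rw [paritySign_zero, one_smul, add_right_inj, neg_eq_iff_add_eq_zero] at h
      rwa [two_smul]
    have h3 : m₁ = 0 := by simpa using h2
    rwa [h3, add_zero]
  · have h2 : (2 : k) • m₀ = 0 := by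
      rw [paritySign_one, neg_one_smul, neg_add, add_left_inj, eq_neg_iff_add_eq_zero] at h
      rwa [two_smul]
    have h3 : m₀ = 0 := by simpa using h2
    rwa [h3, zero_add]

theorem parity_smul (M : Supermodule.{u, v, x} 𝒜) {τ : Aᵐᵒᵖ ≃ₐ[k] Aᵐᵒᵖ}
    (hτ : ∀ i, ∀ a ∈ 𝒜 i, τ (MulOpposite.op a) = paritySign k i • MulOpposite.op a)
    (r : Aᵐᵒᵖ) (m : M) : M.parity (r • m) = τ r • M.parity m := by
  induction r using MulOpposite.rec' with | _ a
  induction a using DirectSum.Decomposition.inductionOn 𝒜 with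
  | zero => simp
  | add a b ha hb => simp [add_smul, ha, hb]
  | @homogeneous j a =>
    refine congrFun (M.parity_eq_of_forall_mem (f := fun m => M.parity (_ • m))
      (g := fun m => τ _ • M.parity m) (by simp) (by simp) fun i m hm => ?_) m
    rw [M.parity_of_mem (M.smul_mem i j m a hm a.2), M.parity_of_mem hm, hτ j a a.2,
      paritySign_add, smul_assoc, smul_comm _ (paritySign k i), smul_smul, mul_comm]

theorem parity_shift (M : Supermodule.{u, v, x} 𝒜) (m : M) :
    M.shift.parity m = -M.parity m := by
  refine congrFun (M.parity_eq_of_forall_mem (f := fun m => M.shift.parity m)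
    (g := fun m => - M.parity m) (fun a b => map_add M.shift.parity a b)
    (fun a b => by rw [map_add, neg_add]; rfl) fun i m hm => ?_) m
  have h : m ∈ M.shift.part (i + 1) := by
    change m ∈ M.part (i + 1 + 1)
    rwa [add_assoc, CharTwo.add_self_eq_zero, add_zero]
  rw [M.shift.parity_of_mem h, M.parity_of_mem hm, paritySign_add, paritySign_one, mul_neg_one,
    ← neg_smul]
  rfl

/-- A linear equivalence that commutes with the parity operators is an even isomorphism. -/
def EvenIso.ofParity [CharZero k] {M N : Supermodule.{u, v, x} 𝒜} (e : M ≃ₗ[Aᵐᵒᵖ] N)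
    (he : ∀ m, e (M.parity m) = N.parity (e m)) : EvenIso M N where
  toEquiv := e
  map_part i m := by
    have h : e (paritySign k i • m) = paritySign k i • e m :=
      e.toLinearMap.map_smul_of_tower (paritySign k i) m
    rw [mem_part_iff, mem_part_iff, ← he, ← e.injective.eq_iff, h]

theorem EvenIso.map_parity {M N : Supermodule.{u, v, x} 𝒜} (e : EvenIso M N) (m : M) :
    e.toEquiv (M.parity m) = N.parity (e.toEquiv m) := by
  refine congrFun (M.parity_eq_of_forall_mem (f := fun m => e.toEquiv (M.parity m))
    (g := fun m => N.parity (e.toEquiv m)) (by simp) (by simp) fun i m hm => ?_) m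
  rw [M.parity_of_mem hm, N.parity_of_mem ((e.map_part i m).2 hm)]
  exact e.toEquiv.toLinearMap.map_smul_of_tower (paritySign k i) m

theorem IsIrreducible.eq_bot_or_eq_top [CharZero k] {M : Supermodule.{u, v, x} 𝒜} (hM : M.IsIrreducible)
    (N : Submodule Aᵐᵒᵖ M) (hN : ∀ n ∈ N, M.parity n ∈ N) : N = ⊥ ∨ N = ⊤ := by
  -- The homogeneous components of `n` are its images under the eigenprojections `(1 ± parity) / 2`.
  refine hM.2 N fun n hn => ⟨(2⁻¹ : k) • (n + M.parity n),
    N.smul_of_tower_mem _ (N.add_mem hn (hN n hn)), (2⁻¹ : k) • (n - M.parity n),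
    N.smul_of_tower_mem _ (N.sub_mem hn (hN n hn)), ?_, ?_, ?_⟩
  · rw [mem_part_iff]
    simp [add_comm]
  · rw [mem_part_iff]
    simp [← smul_neg]
  · rw [← smul_add, add_add_sub_cancel, ← two_smul k n, smul_smul, inv_mul_cancel₀ two_ne_zero,
      one_smul]

theorem isIrreducible_of_parity {M : Supermodule.{u, v, x} 𝒜} (hM : Nontrivial M)
    (h : ∀ N : Submodule Aᵐᵒᵖ M, (∀ n ∈ N, M.parity n ∈ N) → N = ⊥ ∨ N = ⊤) :
    M.IsIrreducible := by
  refine ⟨hM, fun N hN => h N fun n hn => ?_⟩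
  obtain ⟨n₀, h₀, n₁, h₁, h₀', h₁', rfl⟩ := hN n hn
  rw [map_add, M.parity_of_mem h₀', M.parity_of_mem h₁']
  exact N.add_mem (N.smul_of_tower_mem _ h₀) (N.smul_of_tower_mem _ h₁)

/-- Kernel and range are parity-stable both for maps that commute with parity and for those that
anticommute. -/
theorem IsIrreducible.bijective [CharZero k] {M N : Supermodule.{u, v, x} 𝒜} (hM : M.IsIrreducible)
    (hN : N.IsIrreducible) {f : M →ₗ[Aᵐᵒᵖ] N} (hf : f ≠ 0)
    (h : (∀ m, f (M.parity m) = N.parity (f m)) ∨ ∀ m, f (M.parity m) = -N.parity (f m)) :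
    Function.Bijective f := by
  constructor
  · rw [← LinearMap.ker_eq_bot]
    refine (hM.eq_bot_or_eq_top _ fun m hm => ?_).resolve_right
      fun h0 => hf (LinearMap.ker_eq_top.1 h0)
    rw [LinearMap.mem_ker] at hm ⊢
    rcases h with h | h <;> simp [h, hm]
  · rw [← LinearMap.range_eq_top]
    refine (hN.eq_bot_or_eq_top _ ?_).resolve_left fun h0 => hf (LinearMap.range_eq_bot.1 h0)
    rintro _ ⟨m, rfl⟩
    rcases h with h | h
    · exact ⟨_, h m⟩
    · exact ⟨-M.parity m, by rw [map_neg, h, neg_neg]⟩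

/-- The shift negates the parity operator, so an anticommuting map is an even map into `N.shift`. -/
theorem IsIrreducible.isoUpToShift [CharZero k] {M N : Supermodule.{u, v, x} 𝒜} (hM : M.IsIrreducible)
    (hN : N.IsIrreducible) {f : M →ₗ[Aᵐᵒᵖ] N} (hf : f ≠ 0)
    (h : (∀ m, f (M.parity m) = N.parity (f m)) ∨ ∀ m, f (M.parity m) = -N.parity (f m)) :
    IsoUpToShift M N := by
  have hb := hM.bijective hN hf h
  rcases h with h | h
  · exact Or.inl ⟨EvenIso.ofParity (LinearEquiv.ofBijective f hb) h⟩
  · exact Or.inr ⟨EvenIso.ofParity (N := N.shift) (LinearEquiv.ofBijective f hb)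
      fun m => (h m).trans (N.parity_shift _).symm⟩

section OfInvolution

variable [CharZero k] {M : Type x} [AddCommGroup M] [Module k M] [Module Aᵐᵒᵖ M] [IsScalarTower k Aᵐᵒᵖ M]
  (s : M →ₗ[k] M) (hs : ∀ m, s (s m) = m) {τ : Aᵐᵒᵖ ≃ₐ[k] Aᵐᵒᵖ}
  (hτ : ∀ i, ∀ a ∈ 𝒜 i, τ (MulOpposite.op a) = paritySign k i • MulOpposite.op a)
  (hst : ∀ (r : Aᵐᵒᵖ) m, s (r • m) = τ r • s m)

/-- The supermodule with the parity operator `s`. -/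
def ofInvolution : Supermodule.{u, v, x} 𝒜 where
  carrier := M
  part i := LinearMap.ker (s - paritySign k i • LinearMap.id)
  isInternal := by
    rw [DirectSum.isInternal_submodule_iff_isCompl _ zero_ne_one univ_zmod_two]
    constructor
    · rw [Submodule.disjoint_def]
      intro m h0 h1
      simp only [LinearMap.mem_ker, LinearMap.sub_apply, LinearMap.smul_apply,
        LinearMap.id_apply, sub_eq_zero, paritySign_zero, paritySign_one] at h0 h1
      rw [h0, one_smul, neg_one_smul, eq_neg_iff_add_eq_zero, ← two_smul k m] at h1
      simpa using h1
    · rw [codisjoint_iff, eq_top_iff]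
      intro m _
      rw [Submodule.mem_sup]
      refine ⟨(2⁻¹ : k) • (m + s m), ?_, (2⁻¹ : k) • (m - s m), ?_, ?_⟩
      · simp [hs, add_comm]
      · simp [hs]
      · rw [← smul_add, add_add_sub_cancel, ← two_smul k m, smul_smul,
          inv_mul_cancel₀ two_ne_zero, one_smul]
  smul_mem i j m a hm ha := by
    simp only [LinearMap.mem_ker, LinearMap.sub_apply, LinearMap.smul_apply,
        LinearMap.id_apply, sub_eq_zero] at hm ⊢
    rw [hst, hm, hτ j a ha, paritySign_add, smul_assoc, smul_comm _ (paritySign k i), smul_smul,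
      mul_comm]

theorem parity_ofInvolution (m : M) : (ofInvolution s hs hτ hst).parity m = s m := by
  refine congrFun ((ofInvolution s hs hτ hst).parity_eq_of_forall_mem
    (f := fun m => (ofInvolution s hs hτ hst).parity m)
    (g := fun m => s m) (by simp) (fun a b => map_add s a b) fun i m hm => ?_) m
  rw [parity_of_mem _ hm]
  exact (sub_eq_zero.1 hm).symm

end OfInvolution

end Supermodule

namespace Supermodule

variable {k : Type u} [Field k] {A : Type v} [Ring A] [Algebra k A]
  {𝒜 : ZMod 2 → Submodule k A} [GradedAlgebra 𝒜]

theorem exists_linearEquiv_of_involution [CharZero k] {M : Type x} [AddCommGroup M] [Module k M]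
    [Module Aᵐᵒᵖ M] [IsScalarTower k Aᵐᵒᵖ M]
    (s : M →ₗ[k] M) (hs : ∀ m, s (s m) = m) {τ : Aᵐᵒᵖ ≃ₐ[k] Aᵐᵒᵖ}
    (hτ : ∀ i, ∀ a ∈ 𝒜 i, τ (MulOpposite.op a) = paritySign k i • MulOpposite.op a)
    (hst : ∀ (r : Aᵐᵒᵖ) m, s (r • m) = τ r • s m) :
    ∃ (X : Supermodule.{u, v, x} 𝒜) (e : M ≃ₗ[Aᵐᵒᵖ] X), ∀ m, X.parity (e m) = e (s m) :=
  ⟨ofInvolution s hs hτ hst, LinearEquiv.refl _ _, parity_ofInvolution s hs hτ hst⟩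

/-- In `parity ∘ f ∘ t⁻¹` the two twists by `τ` cancel. -/
theorem exists_hom_of_semilinear {τ : Aᵐᵒᵖ ≃ₐ[k] Aᵐᵒᵖ}
    (hτ : ∀ i, ∀ a ∈ 𝒜 i, τ (MulOpposite.op a) = paritySign k i • MulOpposite.op a)
    (hττ : ∀ r, τ (τ r) = r) {S T : Type x} [AddCommGroup S] [Module k S] [Module Aᵐᵒᵖ S]
    [AddCommGroup T] [Module k T] [Module Aᵐᵒᵖ T] {t : S ≃ₗ[k] T}
    (ht : ∀ (r : Aᵐᵒᵖ) v, t (r • v) = τ r • t v) {M : Supermodule.{u, v, x} 𝒜}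
    (f : S →ₗ[Aᵐᵒᵖ] M) : ∃ g : T →ₗ[Aᵐᵒᵖ] M, ∀ v, g (t v) = M.parity (f v) := by
  refine ⟨{ toFun := fun w => M.parity (f (t.symm w))
            map_add' := by simp
            map_smul' := fun r w => ?_ }, fun v => ?_⟩
  · have h : t.symm (r • w) = τ r • t.symm w := by
      apply t.injective
      rw [ht, hττ, LinearEquiv.apply_symm_apply, LinearEquiv.apply_symm_apply]
    rw [h, map_smul, M.parity_smul hτ, hττ, RingHom.id_apply]
  · change M.parity (f (t.symm (t v))) = _
    rw [LinearEquiv.symm_apply_apply]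

/-- The supermodule `X` is irreducible, it is the unique one that contains the simple module
`S i`, and its only simple constituents are `S i` and `S j`. -/
structure IsCoverOf {ι : Type} (S : ι → Type x) [∀ i, AddCommGroup (S i)]
    [∀ i, Module Aᵐᵒᵖ (S i)] (X : Supermodule.{u, v, x} 𝒜) (i j : ι) : Prop where
  isIrreducible : X.IsIrreducible
  exists_ne_zero : ∃ f : S i →ₗ[Aᵐᵒᵖ] X, f ≠ 0
  eq_or_eq : ∀ l (f : S l →ₗ[Aᵐᵒᵖ] X), f ≠ 0 → l = i ∨ l = j
  isoUpToShift : ∀ M : Supermodule.{u, v, x} 𝒜, M.IsIrreducible →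
    ∀ f : S i →ₗ[Aᵐᵒᵖ] M, f ≠ 0 → IsoUpToShift X M

/-! ### Irreducible supermodules from orbits of simple modules -/

section Cover

variable [CharZero k] {τ : Aᵐᵒᵖ ≃ₐ[k] Aᵐᵒᵖ}
  (hτ : ∀ i, ∀ a ∈ 𝒜 i, τ (MulOpposite.op a) = paritySign k i • MulOpposite.op a)
  {ι : Type} {S : ι → Type x} [∀ i, AddCommGroup (S i)] [∀ i, Module k (S i)]
  [∀ i, Module Aᵐᵒᵖ (S i)] [∀ i, IsScalarTower k Aᵐᵒᵖ (S i)]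
  (D : SimpleSystem k Aᵐᵒᵖ S)

include hτ D

/-- The rescaled semilinear map `s` grades `S i` itself. An isomorphism with the shift would
anticommute with `s`, but by Schur's lemma it is a scalar. -/
theorem exists_isCoverOf_of_fixed [IsAlgClosed k] (hττ : ∀ r, τ (τ r) = r) {i : ι}
    {t : S i ≃ₗ[k] S i} (ht : ∀ (r : Aᵐᵒᵖ) v, t (r • v) = τ r • t v) :
    ∃ X : Supermodule.{u, v, x} 𝒜, X.IsCoverOf S i i ∧ ¬ X.IsSelfAssociate := by
  obtain ⟨s, hs, hst⟩ := D.exists_involution hττ ht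
  obtain ⟨X, e, he⟩ := exists_linearEquiv_of_involution s hs hτ hst
  have := D.simple i
  have := D.finite i
  have := IsSimpleModule.nontrivial Aᵐᵒᵖ (S i)
  have hX : IsSimpleModule Aᵐᵒᵖ X := IsSimpleModule.congr e.symm
  have hirr : X.IsIrreducible :=
    isIrreducible_of_parity (IsSimpleModule.nontrivial Aᵐᵒᵖ X) fun N _ => eq_bot_or_eq_top N
  refine ⟨X, ⟨hirr, ⟨e.toLinearMap, fun h => ?_⟩, fun l f hf => Or.inl ?_, fun M hM f hf => ?_⟩,
    ?_⟩
  · obtain ⟨v, hv⟩ := exists_ne (0 : S i)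
    have h1 : e v = 0 := LinearMap.congr_fun h v
    exact hv (e.map_eq_zero_iff.1 h1)
  · refine D.eq_of_ne_zero (f := e.symm.toLinearMap.comp f) fun h => hf (LinearMap.ext fun v => ?_)
    have h1 : e.symm (f v) = 0 := LinearMap.congr_fun h v
    exact e.symm.map_eq_zero_iff.1 h1
  · obtain ⟨g, hg⟩ : ∃ g : X →ₗ[Aᵐᵒᵖ] M, g ≠ 0 :=
      ⟨f.comp e.symm.toLinearMap, fun h => hf (LinearMap.ext fun v => by
        simpa using LinearMap.congr_fun h (e v))⟩
    -- With `g'` the parity conjugate of `g`, the sum `g + g'` is even and `g - g'` is odd; they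
    -- cannot both vanish.
    let g' : X →ₗ[Aᵐᵒᵖ] M :=
      { toFun := fun m => M.parity (g (X.parity m))
        map_add' := by simp
        map_smul' := fun r m => by
          rw [X.parity_smul hτ, map_smul, M.parity_smul hτ, hττ, RingHom.id_apply] }
    have hg' : ∀ m, g' m = M.parity (g (X.parity m)) := fun _ => rfl
    by_cases h : g + g' = 0
    · refine hirr.isoUpToShift hM (f := g - g') (fun h' => hg (LinearMap.ext fun m => ?_))
        (Or.inr fun m => ?_)
      · have h1 := LinearMap.congr_fun h m
        have h2 := LinearMap.congr_fun h' m
        simp only [LinearMap.add_apply, LinearMap.sub_apply, LinearMap.zero_apply] at h1 h2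
        have h3 : (2 : k) • g m = 0 := by
          rw [two_smul]
          calc g m + g m = (g m + g' m) + (g m - g' m) := by abel
            _ = 0 := by rw [h1, h2, add_zero]
        simpa using h3
      · simp [hg']
    · refine hirr.isoUpToShift hM h (Or.inl fun m => ?_)
      simp [hg', add_comm]
  · rintro ⟨f₀⟩
    let f : X ≃ₗ[Aᵐᵒᵖ] X := f₀.toEquiv
    have hf : ∀ m, f (X.parity m) = -X.parity (f m) := fun m =>
      (f₀.map_parity m).trans (X.parity_shift _)
    let g : S i →ₗ[Aᵐᵒᵖ] S i := e.symm.toLinearMap.comp (f.toLinearMap.comp e.toLinearMap)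
    have hg : ∀ v, e (g v) = f (e v) := fun v => e.apply_symm_apply _
    have hgs : ∀ v, g (s v) = - s (g v) := fun v => e.injective (by
      rw [hg, ← he, hf, map_neg, ← he, hg])
    obtain ⟨μ, hμ⟩ := IsSimpleModule.exists_eq_smul_of_commute (R := Aᵐᵒᵖ)
      (g.restrictScalars k) fun r v => g.map_smul r v
    have hμ' : ∀ v, g v = μ • v := hμ
    obtain ⟨v, hv⟩ := exists_ne (0 : S i)
    have h1 := hgs v
    rw [hμ', hμ', map_smul, eq_neg_iff_add_eq_zero, ← two_smul k, ← hμ'] at h1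
    have h2 : g (s v) = 0 := by simpa using h1
    have h3 : f (e (s v)) = 0 := by rw [← hg, h2, map_zero]
    have h4 : e (s v) = 0 := f.map_eq_zero_iff.1 h3
    have h5 : s v = 0 := e.map_eq_zero_iff.1 h4
    exact hv (by rw [← hs v, h5, map_zero])

/-- The sum `S i ⊕ S j` is graded by the swap through `t`. The automorphism `(a, b) ↦ (a, -b)`
anticommutes with the swap, which gives self-associateness. -/
theorem exists_isCoverOf_of_ne (hττ : ∀ r, τ (τ r) = r) {i j : ι} (hij : i ≠ j)
    {t : S i ≃ₗ[k] S j} (ht : ∀ (r : Aᵐᵒᵖ) v, t (r • v) = τ r • t v) :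
    ∃ X : Supermodule.{u, v, x} 𝒜, X.IsCoverOf S i j ∧ X.IsSelfAssociate := by
  classical
  have ht' : ∀ (r : Aᵐᵒᵖ) w, t.symm (r • w) = τ r • t.symm w := fun r w => by
    apply t.injective
    rw [ht, hττ, LinearEquiv.apply_symm_apply, LinearEquiv.apply_symm_apply]
  let s : S i × S j →ₗ[k] S i × S j :=
    ((t.symm.toLinearMap.comp (LinearMap.snd k _ _)).prod
      (t.toLinearMap.comp (LinearMap.fst k _ _)))
  have hsa : ∀ a b, s (a, b) = (t.symm b, t a) := fun _ _ => rfl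
  obtain ⟨X, e, he⟩ := exists_linearEquiv_of_involution s (fun m => by simp [s]) hτ
    (fun r m => by simp [s, ht, ht'])
  have := D.simple i
  have := IsSimpleModule.nontrivial Aᵐᵒᵖ (S i)
  have hirr : X.IsIrreducible := by
    refine isIrreducible_of_parity e.symm.toEquiv.nontrivial fun N hN => ?_
    rw [or_iff_not_imp_left]
    intro hN0
    obtain ⟨a, ha, hne⟩ : ∃ a : S i, e (a, 0) ∈ N ∧ a ≠ 0 := by
      obtain ⟨n, hn, hn0⟩ := (Submodule.ne_bot_iff N).1 hN0
      obtain ⟨⟨a, b⟩, rfl⟩ := e.surjective n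
      -- A central idempotent projects to `S i`, since `i ≠ j`. If the first component is zero,
      -- parity is applied beforehand to bring the second one there.
      have key : ∀ a b, e (a, b) ∈ N → e (a, 0) ∈ N := fun a b h => by
        have h1 := N.smul_mem (D.ofChar (Pi.single i 1)) h
        rw [← map_smul, Prod.smul_mk, D.ofChar_smul, D.ofChar_smul] at h1
        simpa [hij.symm] using h1
      by_cases ha : a = 0
      · refine ⟨t.symm b, key _ (t a) ?_, fun hb => hn0 ?_⟩
        · have h1 := hN _ hn
          rwa [he] at h1
        · rw [t.symm.map_eq_zero_iff] at hb
          rw [ha, hb]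
          exact map_zero e
      · exact ⟨a, key a b hn, ha⟩
    have htop : N.comap (e.toLinearMap.comp (LinearMap.inl Aᵐᵒᵖ (S i) (S j))) = ⊤ :=
      (eq_bot_or_eq_top _).resolve_left fun h => hne ((Submodule.mem_bot Aᵐᵒᵖ).1 (h ▸ ha))
    have h1 : ∀ a : S i, e (a, 0) ∈ N := fun a => by
      have : a ∈ N.comap (e.toLinearMap.comp (LinearMap.inl Aᵐᵒᵖ (S i) (S j))) :=
        htop ▸ Submodule.mem_top
      exact this
    rw [eq_top_iff]
    rintro n -
    obtain ⟨⟨a, b⟩, rfl⟩ := e.surjective n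
    have h2 := hN _ (h1 (t.symm b))
    rw [he, hsa, map_zero, LinearEquiv.apply_symm_apply] at h2
    have h3 := N.add_mem (h1 a) h2
    rw [← map_add] at h3
    simpa using h3
  refine ⟨X, ⟨hirr, ⟨e.toLinearMap.comp (LinearMap.inl _ _ _), fun h => ?_⟩, fun l f hf => ?_,
    fun M hM f hf => ?_⟩, ⟨?_⟩⟩
  · obtain ⟨v, hv⟩ := exists_ne (0 : S i)
    have h1 : e (v, 0) = 0 := LinearMap.congr_fun h v
    rw [e.map_eq_zero_iff] at h1
    exact hv (congrArg Prod.fst h1)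
  · by_contra! h
    refine hf (LinearMap.ext fun v => e.symm.injective ?_)
    have h1 := mt (D.eq_of_ne_zero
      (f := (LinearMap.fst Aᵐᵒᵖ (S i) (S j)).comp (e.symm.toLinearMap.comp f))) h.1
    have h2 := mt (D.eq_of_ne_zero
      (f := (LinearMap.snd Aᵐᵒᵖ (S i) (S j)).comp (e.symm.toLinearMap.comp f))) h.2
    rw [not_not] at h1 h2
    rw [LinearMap.zero_apply, map_zero]
    exact Prod.ext (LinearMap.congr_fun h1 v) (LinearMap.congr_fun h2 v)
  -- Extending `f` to `S j` by its parity transform makes the combined map even.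
  · obtain ⟨f', hf'⟩ := exists_hom_of_semilinear hτ hττ ht f
    have hf'' : ∀ b, f' b = M.parity (f (t.symm b)) := fun b => by
      rw [← hf', LinearEquiv.apply_symm_apply]
    let g : X →ₗ[Aᵐᵒᵖ] M := (f.coprod f').comp e.symm.toLinearMap
    have hg : ∀ a b, g (e (a, b)) = f a + f' b := fun a b => by simp [g]
    refine hirr.isoUpToShift hM (f := g) (fun h => hf (LinearMap.ext fun a => ?_))
      (Or.inl fun m => ?_)
    · have h1 := hg a 0
      rw [h, map_zero, add_zero] at h1
      exact h1.symm
    · obtain ⟨⟨a, b⟩, rfl⟩ := e.surjective m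
      rw [he, hsa, hg, hg, map_add, hf', hf'', parity_parity, add_comm]
  · let g : X ≃ₗ[Aᵐᵒᵖ] X := e.symm.trans
      (((LinearEquiv.refl Aᵐᵒᵖ (S i)).prodCongr (LinearEquiv.neg Aᵐᵒᵖ)).trans e)
    have hg : ∀ a b, g (e (a, b)) = e (a, -b) := fun a b => by simp [g]
    have hgp : ∀ m, g (X.parity m) = -X.parity (g m) := fun m => by
      obtain ⟨⟨a, b⟩, rfl⟩ := e.surjective m
      rw [he, hsa, hg, hg, he, hsa, ← map_neg e]
      simp
    exact EvenIso.ofParity (N := X.shift) g fun m => (hgp m).trans (X.parity_shift _).symm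

variable {π : ι → ι}

theorem exists_isCoverOf [IsAlgClosed k] (hD : D.IsTwistedBy τ π) (i : ι) :
    ∃ X : Supermodule.{u, v, x} 𝒜, X.IsCoverOf S i (π i) ∧ (X.IsSelfAssociate ↔ π i ≠ i) := by
  have h := hD.exists_semilinear i
  by_cases hi : π i = i
  · rw [hi] at h ⊢
    obtain ⟨t, ht⟩ := h
    obtain ⟨X, hX, hX'⟩ := exists_isCoverOf_of_fixed hτ D hD.apply_apply ht
    exact ⟨X, hX, by simpa using hX'⟩
  · obtain ⟨t, ht⟩ := h
    obtain ⟨X, hX, hX'⟩ := exists_isCoverOf_of_ne hτ D hD.apply_apply (Ne.symm hi) ht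
    exact ⟨X, hX, by simp [hX', hi]⟩

/-- The condition `i ≤ π i` selects one element of each orbit. -/
theorem exists_bijective_irredClass [IsAlgClosed k] [IsSemisimpleRing Aᵐᵒᵖ] [LinearOrder ι]
    (hD : D.IsTwistedBy τ π) :
    ∃ F : {i // i ≤ π i} → IrredClass.{u, v, x} 𝒜, Function.Bijective F ∧
      ∀ i, (F i).IsSelfAssociate ↔ π i ≠ i := by
  choose X hX hX' using exists_isCoverOf (𝒜 := 𝒜) hτ D hD
  have key : ∀ i l, IsoUpToShift (X i) (X l) → i = l ∨ i = π l := fun i l h => by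
    obtain ⟨e⟩ : Nonempty (X i ≃ₗ[Aᵐᵒᵖ] X l) := by
      rcases h with ⟨⟨e⟩⟩ | ⟨⟨e⟩⟩
      exacts [⟨e.toEquiv⟩, ⟨e.toEquiv⟩]
    obtain ⟨f, hf⟩ := (hX i).exists_ne_zero
    refine (hX l).eq_or_eq i (e.toLinearMap.comp f) fun h0 => hf (LinearMap.ext fun v => ?_)
    exact e.map_eq_zero_iff.1 (LinearMap.congr_fun h0 v)
  refine ⟨fun i => Quotient.mk _ ⟨X i, (hX i).isIrreducible⟩, ⟨fun i l h => ?_, fun q => ?_⟩,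
    fun i => hX' i⟩
  · have h1 : IsoUpToShift (X i) (X l) := Quotient.exact h
    refine Subtype.ext ?_
    rcases key _ _ h1 with h2 | h2
    · exact h2
    · have h3 := i.2
      have h4 := l.2
      rw [h2, hD.involutive] at h3
      rw [h2]
      exact le_antisymm h3 h4
  · obtain ⟨⟨M, hM⟩, rfl⟩ := Quotient.exists_rep q
    have := hM.1
    obtain ⟨j, f, hf⟩ := D.exists_submodule (M := M)
    rcases le_total j (π j) with hj | hj
    · exact ⟨⟨j, hj⟩, Quotient.sound ((hX j).isoUpToShift M hM f hf)⟩
    -- If the simple submodule found is not the chosen representative, parity carries it to a copy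
    -- of `S (π j)` in `M`.
    · obtain ⟨t, ht⟩ := hD.exists_semilinear j
      obtain ⟨g, hg⟩ := exists_hom_of_semilinear hτ hD.apply_apply ht f
      refine ⟨⟨π j, by rwa [hD.involutive]⟩,
        Quotient.sound ((hX (π j)).isoUpToShift M hM g fun h => hf (LinearMap.ext fun v => ?_))⟩
      have h1 := hg v
      rw [h, LinearMap.zero_apply] at h1
      rw [← M.parity_parity (f v), ← h1, map_zero, LinearMap.zero_apply]

end Cover

end Supermodule

end

/-! ### Comparison of the two counts -/

theorem mainTheorem7 (k : Type u) [Field k] [IsAlgClosed k] [CharZero k]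
    (G : Type v) [Group G] [Finite G] (deg : G →* Multiplicative (ZMod 2))
    (c : TwoCocycle G k) :
    Finite (Supermodule.IrredClass.{u, max u v, max u w} (TwistedGroupAlgebra.grading c deg)) ∧
    Nat.card (Supermodule.IrredClass.{u, max u v, max u w} (TwistedGroupAlgebra.grading c deg)) =
      Nat.card {C : ConjClasses G // ConjClassHasDegree deg C 0 ∧ c.IsRegular C} ∧
    Nat.card {q : Supermodule.IrredClass.{u, max u v, max u w}
        (TwistedGroupAlgebra.grading c deg) // q.IsSelfAssociate} =
      Nat.card {C : ConjClasses G // ConjClassHasDegree deg C 1 ∧ c.IsRegular C} := by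
  have : Module.Finite k (TwistedGroupAlgebra c)ᵐᵒᵖ :=
    Module.Finite.equiv (MulOpposite.opLinearEquiv k)
  obtain ⟨n, d, hd, ⟨Φ⟩⟩ :=
    IsSemisimpleRing.exists_algEquiv_pi_matrix_of_isAlgClosed k (TwistedGroupAlgebra c)ᵐᵒᵖ
  let D := ColumnModule.simpleSystem.{u, max u v, w} Φ hd
  let σ := TwistedGroupAlgebra.parityEquiv c deg
  let τ := AlgEquiv.op σ
  have hτ : ∀ i, ∀ a ∈ TwistedGroupAlgebra.grading c deg i,
      τ (MulOpposite.op a) = paritySign k i • MulOpposite.op a := fun i a ha =>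
    congrArg MulOpposite.op (TwistedGroupAlgebra.parityEquiv_of_mem c deg ha)
  obtain ⟨π, hD⟩ := D.exists_isTwistedBy (τ := τ) fun r =>
    congrArg MulOpposite.op (TwistedGroupAlgebra.parityEquiv_parityEquiv c deg r.unop)
  obtain ⟨F, hF, hF'⟩ := Supermodule.exists_bijective_irredClass hτ D hD
  -- For `i = 0` the condition at fixed points is vacuous and all orbits are counted; for `i = 1` it
  -- excludes fixed points, as `-1 ≠ 1`.
  have hcard : ∀ i, Nat.card {l // l ≤ π l ∧ (π l = l → paritySign k i = 1)} =
      Nat.card {C : ConjClasses G // ConjClassHasDegree deg C i ∧ c.IsRegular C} := fun i => by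
    rw [← TwistedGroupAlgebra.finrank_signedCenter c deg i,
      (signedCenterOpEquiv σ _).finrank_eq]
    exact (SimpleSystem.finrank_signedCenter hD (paritySign_mul_self k i)).symm
  let E := Equiv.ofBijective F hF
  refine ⟨Finite.of_equiv _ E, ?_, ?_⟩
  · rw [← hcard, ← Nat.card_congr E]
    exact Nat.card_congr (Equiv.subtypeEquivRight fun l => by simp)
  · rw [← hcard, ← Nat.card_congr (E.subtypeEquiv (p := fun l : {i // i ≤ π i} => π l ≠ l)
      fun l => (hF' l).symm)]
    have h1 : (-1 : k) ≠ 1 := by norm_num [neg_eq_iff_add_eq_zero]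
    refine Nat.card_congr ((Equiv.subtypeSubtypeEquivSubtypeInter _ fun l => π l ≠ l).trans
      (Equiv.subtypeEquivRight fun l => ?_))
    simp [h1]
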